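/- Let $x_1,\dots,x_n$ be self-adjoint (in general unbounded) operators on a complex Hilbert space which satisfy the canonical commutation relations $[x_j,x_k]=i\theta_{jk}$ with a real antisymmetric matrix $\Theta=(\theta_{jk})$, understood also in the exponentiated (Weyl) form $e^{iu^{T}x}e^{iv^{T}x}=e^{-\frac{i}{2}u^{T}\Theta v}\,e^{i(u+v)^{T}x}$ for all $u,v\in\mathbb{R}^n$. Let $\rho$ be a density operator, $\mathbf{E}A:=\mathrm{Tr}(\rho A)$ the quantum expectation, $\xi:=x-\mathbf{E}x$, $S:=\mathbf{E}(\xi\xi^{T})$ the quantum covariance matrix and $\Sigma:=\mathrm{Re}\,S$. Suppose that the state is Gaussian, that is, the means and covariances exist and $\mathbf{E}e^{iu^{T}\xi}=e^{-\frac12 u^{T}\Sigma u}$ for all $u\in\mathbb{R}^n$. Then all the fourth-order moments $\mathbf{E}(\xi_j\xi_k\xi_\ell\xi_m)$ exist and $S=\Sigma+\frac{i}{2}\Theta$. Let $\varphi_{jk\ell m}:=\mathrm{Re}\,\mathbf{E}(\xi_j\xi_k\xi_\ell\xi_m)$ and $$\psi_{jk\ell m}:=\tfrac18\big(\varphi_{jk\ell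 m}+\varphi_{jkm\ell}+\varphi_{kj\ell m}+\varphi_{kjm\ell}+\varphi_{\ell mjk}+\varphi_{m\ell jk}+\varphi_{\ell mkj}+\varphi_{m\ell kj}\big),$$ and let $\Psi(R):=\big(\sum_{\ell,m=1}^n\psi_{jk\ell m}r_{\ell m}\big)_{1\le j,k\le n}$ for matrices $R=(r_{\ell m})$ in the space $\mathbb{S}_n$ of real symmetric matrices of order $n$, with the Frobenius inner product $\langle X,Y\rangle=\mathrm{Tr}(XY)$. Then $$\Psi(R)=\Sigma\langle\Sigma,R\rangle+2K(R),\qquad R\in\mathbb{S}_n,$$ where $K(R):=\Sigma R\Sigma+\tfrac14\Theta R\Theta$ is a positive semidefinite self-adjoint operator on $\mathbb{S}_n$. If, moreover, $S$ is nonsingular, then $K$ is positive definite. -/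

import Mathlib

open scoped Matrix

universe u

namespace QuantumGaussian

section Operators

variable {H : Type u} [NormedAddCommGroup H] [InnerProductSpace ℂ H]

/-- The product `A B` of two unbounded operators, `ψ ↦ A (B ψ)`, on its natural domain
`{ψ ∈ dom B | B ψ ∈ dom A}`. -/
def opMul (A B : H →ₗ.[ℂ] H) : H →ₗ.[ℂ] H where
  domain := (A.domain.comap B.toFun).map B.domain.subtype
  toFun :=
    { toFun := fun ψ =>
        A ⟨B ⟨ψ, by obtain ⟨φ, -, h⟩ := ψ.2; exact h ▸ φ.2⟩, by
          obtain ⟨ψ, φ, hφ, rfl⟩ := ψ; exact hφ⟩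
      map_add' := by
        intro ψ φ
        rw [← LinearPMap.map_add]
        congr 1
        ext
        simp only [Submodule.coe_add]
        rw [← LinearPMap.map_add]
        rfl
      map_smul' := by
        intro c ψ
        rw [RingHom.id_apply, ← LinearPMap.map_smul]
        congr 1
        ext
        simp only [Submodule.coe_smul]
        rw [← LinearPMap.map_smul]
        rfl }

/-- The scalar multiple `c I` of the identity, as an operator defined on the whole space. -/
def scalarOp (c : ℂ) : H →ₗ.[ℂ] H :=
  (c • (LinearMap.id : H →ₗ[ℂ] H)).toPMap ⊤

/-- A bounded operator, regarded as an operator with domain the whole space. -/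
def boundedOp (T : H →L[ℂ] H) : H →ₗ.[ℂ] H :=
  (T : H →ₗ[ℂ] H).toPMap ⊤

/-- The real linear combination `uᵀ x = ∑ j, u j • x j` of unbounded operators, on the
intersection of their domains. -/
noncomputable def linComb {n : ℕ} (u : Fin n → ℝ) (x : Fin n → H →ₗ.[ℂ] H) : H →ₗ.[ℂ] H :=
  ∑ j, (u j : ℂ) • x j

/-- An everywhere defined operator `T` is of trace class with trace `c`: the diagonal sum of `T`
converges unconditionally to `c` in every orthonormal basis. -/
def HasTrace (T : H → H) (c : ℂ) : Prop :=
  ∀ (ι : Type u) (b : HilbertBasis ι ℂ H), HasSum (fun i => inner ℂ (b i) (T (b i))) c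

/-- `E A = Tr (ρ A)` exists and equals `c`, for a possibly unbounded operator `A`. As `ρ A` is only
densely defined, the trace is taken of `A ρ`: the range of `ρ` has to lie in the domain of `A`,
and `A ρ` has to be of trace class with trace `c`. -/
def HasExpectation (ρ : H →L[ℂ] H) (A : H →ₗ.[ℂ] H) (c : ℂ) : Prop :=
  ∃ h : ∀ ψ, ρ ψ ∈ A.domain, HasTrace (fun ψ => A ⟨ρ ψ, h ψ⟩) c

open Classical in
/-- The quantum expectation `E A = Tr (ρ A)` (zero by convention if it does not exist). -/
noncomputable def expectation (ρ : H →L[ℂ] H) (A : H →ₗ.[ℂ] H) : ℂ :=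
  if h : ∃ c, HasExpectation ρ A c then h.choose else 0

variable [CompleteSpace H]

/-- A density operator: a positive semidefinite self-adjoint operator with unit trace. -/
def IsDensityOperator (ρ : H →L[ℂ] H) : Prop :=
  ρ.IsPositive ∧ HasTrace ρ 1

/-- `U t = exp (i t A)`: `U` is the strongly continuous one-parameter unitary group whose
infinitesimal generator is `i A`, with equality of domains. -/
structure IsExpGroup (A : H →ₗ.[ℂ] H) (U : ℝ → H →L[ℂ] H) : Prop where
  unitary : ∀ t, U t ∈ unitary (H →L[ℂ] H)
  zero : U 0 = 1
  add : ∀ s t, U (s + t) = U s * U t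
  cont : ∀ ψ, Continuous fun t => U t ψ
  generator : ∀ ψ φ, (ψ, φ) ∈ A.graph ↔ HasDerivAt (fun t => U t ψ) (Complex.I • φ) 0

end Operators

/-- A vector `x = (x 1, …, x n)` of observables (self-adjoint operators on `H`) which satisfy the
canonical commutation relations `[x, xᵀ] = i Θ`, together with the unitary operators
`W u = exp (i uᵀ x)`. The operator `uᵀ x` in the exponent is the closure of the sum `∑ j, u j x j`.
The commutation relations are required on the natural domain of the commutators and, the operators
being unbounded, in the exponentiated form
`exp (i uᵀ x) exp (i vᵀ x) = exp (- i uᵀ Θ v / 2) exp (i (u + v)ᵀ x)`. -/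
structure CanonicalSystem (n : ℕ) (H : Type u) [NormedAddCommGroup H] [InnerProductSpace ℂ H]
    [CompleteSpace H] where
  x : Fin n → H →ₗ.[ℂ] H
  Θ : Matrix (Fin n) (Fin n) ℝ
  W : (Fin n → ℝ) → H →L[ℂ] H
  selfAdjoint : ∀ j, IsSelfAdjoint (x j)
  antisymm : Θᵀ = -Θ
  ccr : ∀ j k, opMul (x j) (x k) - opMul (x k) (x j) ≤ scalarOp (Complex.I * Θ j k)
  exp_W : ∀ u, IsExpGroup (linComb u x).closure fun t => W (t • u)
  weyl : ∀ u v, W u * W v =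
    Complex.exp (-(Complex.I / 2) * ((u ⬝ᵥ (Θ *ᵥ v) : ℝ) : ℂ)) • W (u + v)

namespace CanonicalSystem

variable {n : ℕ} {H : Type u} [NormedAddCommGroup H] [InnerProductSpace ℂ H] [CompleteSpace H]

/-- The centered observables `ξ = x - E x`. -/
noncomputable def ξ (sys : CanonicalSystem n H) (ρ : H →L[ℂ] H) (j : Fin n) : H →ₗ.[ℂ] H :=
  sys.x j - scalarOp (expectation ρ (sys.x j))

/-- The unitary operators `exp (i uᵀ ξ) = exp (- i uᵀ E x) exp (i uᵀ x)`. -/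
noncomputable def centeredW (sys : CanonicalSystem n H) (ρ : H →L[ℂ] H) (u : Fin n → ℝ) :
    H →L[ℂ] H :=
  Complex.exp (-Complex.I * ∑ j, (u j : ℂ) * expectation ρ (sys.x j)) • sys.W u

/-- The quantum covariance matrix `S = E (ξ ξᵀ)`. -/
noncomputable def S (sys : CanonicalSystem n H) (ρ : H →L[ℂ] H) : Matrix (Fin n) (Fin n) ℂ :=
  Matrix.of fun j k => expectation ρ (opMul (sys.ξ ρ j) (sys.ξ ρ k))

/-- The matrix `Σ = Re E (ξ ξᵀ)`. -/
noncomputable def Sig (sys : CanonicalSystem n H) (ρ : H →L[ℂ] H) : Matrix (Fin n) (Fin n) ℝ :=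
  Matrix.of fun j k => (expectation ρ (opMul (sys.ξ ρ j) (sys.ξ ρ k))).re

/-- The operator `ξ j ξ k ξ l ξ m`. -/
noncomputable def ξ4 (sys : CanonicalSystem n H) (ρ : H →L[ℂ] H) (j k l m : Fin n) :
    H →ₗ.[ℂ] H :=
  opMul (sys.ξ ρ j) (opMul (sys.ξ ρ k) (opMul (sys.ξ ρ l) (sys.ξ ρ m)))

/-- The real fourth-order central moments `φ j k l m = Re E (ξ j ξ k ξ l ξ m)`. -/
noncomputable def φ (sys : CanonicalSystem n H) (ρ : H →L[ℂ] H) (j k l m : Fin n) : ℝ :=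
  (expectation ρ (sys.ξ4 ρ j k l m)).re

/-- The partial symmetrisation `ψ` of the tensor `φ`. -/
noncomputable def ψ (sys : CanonicalSystem n H) (ρ : H →L[ℂ] H) (j k l m : Fin n) : ℝ :=
  (sys.φ ρ j k l m + sys.φ ρ j k m l + sys.φ ρ k j l m + sys.φ ρ k j m l
    + sys.φ ρ l m j k + sys.φ ρ m l j k + sys.φ ρ l m k j + sys.φ ρ m l k j) / 8

/-- The state `ρ` is Gaussian: the means and the quantum covariances of the observables exist, and
the quantum characteristic function of the centered observables is
`E exp (i uᵀ ξ) = exp (- uᵀ Σ u / 2)`. -/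
structure IsGaussian (sys : CanonicalSystem n H) (ρ : H →L[ℂ] H) : Prop where
  mean : ∀ j, ∃ c, HasExpectation ρ (sys.x j) c
  covariance : ∀ j k, ∃ c, HasExpectation ρ (opMul (sys.ξ ρ j) (sys.ξ ρ k)) c
  charFun : ∀ u : Fin n → ℝ, HasExpectation ρ (boundedOp (sys.centeredW ρ u))
    (Complex.exp (-((u ⬝ᵥ (sys.Sig ρ *ᵥ u) : ℝ) : ℂ) / 2))

end CanonicalSystem

/-- The space of real symmetric matrices of order `n`. -/
def SymMat (n : ℕ) : Submodule ℝ (Matrix (Fin n) (Fin n) ℝ) where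
  carrier := {R | R.IsSymm}
  add_mem' := fun hA hB => Matrix.IsSymm.add hA hB
  zero_mem' := Matrix.isSymm_zero
  smul_mem' := fun c _ hA => Matrix.IsSymm.smul hA c

/-- The Frobenius inner product `⟨X, Y⟩ = Tr (X Y)` of real symmetric matrices. -/
def frob {n : ℕ} (X Y : Matrix (Fin n) (Fin n) ℝ) : ℝ :=
  (X * Y).trace

/-- A positive semidefinite self-adjoint operator on the space of real symmetric matrices. -/
structure IsPosSemidefOp {n : ℕ} (L : SymMat n →ₗ[ℝ] SymMat n) : Prop where
  selfAdjoint : ∀ R T : SymMat n,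
    frob (L R : Matrix (Fin n) (Fin n) ℝ) T = frob (R : Matrix (Fin n) (Fin n) ℝ) (L T)
  nonneg : ∀ R : SymMat n, 0 ≤ frob (R : Matrix (Fin n) (Fin n) ℝ) (L R)

/-- A positive definite self-adjoint operator on the space of real symmetric matrices. -/
structure IsPosDefOp {n : ℕ} (L : SymMat n →ₗ[ℝ] SymMat n) : Prop where
  selfAdjoint : ∀ R T : SymMat n,
    frob (L R : Matrix (Fin n) (Fin n) ℝ) T = frob (R : Matrix (Fin n) (Fin n) ℝ) (L T)
  pos : ∀ R : SymMat n, R ≠ 0 → 0 < frob (R : Matrix (Fin n) (Fin n) ℝ) (L R)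

namespace CanonicalSystem

variable {n : ℕ} {H : Type u} [NormedAddCommGroup H] [InnerProductSpace ℂ H] [CompleteSpace H]

/-- The operator `Ψ (R) = (∑ l m, ψ j k l m * R l m)` on the space of real symmetric matrices. -/
noncomputable def Ψ (sys : CanonicalSystem n H) (ρ : H →L[ℂ] H) : SymMat n →ₗ[ℝ] SymMat n where
  toFun R := ⟨Matrix.of fun j k =>
      ∑ l, ∑ m, sys.ψ ρ j k l m * (R : Matrix (Fin n) (Fin n) ℝ) l m, by
    refine Matrix.IsSymm.ext fun j k => ?_
    rw [Matrix.of_apply, Matrix.of_apply]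
    refine Finset.sum_congr rfl fun l _ => Finset.sum_congr rfl fun m _ => ?_
    simp only [ψ]
    ring⟩
  map_add' R T := by
    ext j k
    simp [mul_add, Finset.sum_add_distrib]
  map_smul' c R := by
    ext j k
    simp [Finset.mul_sum, mul_left_comm]

end CanonicalSystem

end QuantumGaussian

/-!
The proof realises the Gaussian state as a vector in the Hilbert space of Hilbert–Schmidt operators
and turns products of the observables into derivatives of the characteristic function.

Let `s` be the self-adjoint square root of `ρ` and `F u = exp (i uᵀ ξ) s`. By the Weyl relations
the Gram kernel is explicit,
`⟪F v, F u⟫ = exp (i vᵀ Θ u / 2) * χ (u - v)` with `χ u = exp (-uᵀ Σ u / 2)`,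
hence smooth, and a Hilbert space valued map with a smooth Gram kernel is itself smooth
(`contDiff_of_contDiff_gram`): the inner products of its difference quotients are mixed difference
quotients of the kernel, so the difference quotients are Cauchy. This regularity is what makes the
range of `ρ` lie in the domains of all products of the `ξ j`.

The Weyl relations also show that `ξ j` acts on the orbits `u ↦ F u φ` as the first order operator
`D j = -i ∂ⱼ - ½ (Θ u)ⱼ`. As `ξ j` is closed, it commutes with further differentiation in `u`, so
that `ξ j ξ k ξ l ξ m` acts as `D m D l D k D j`, in the reverse order. Pairing with `F 0 = s` gives
`E (ξ j ξ k ξ l ξ m) = (D m D l D k D j χ) (0)`; the diagonal sums in an arbitrary orthonormal basis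
are controlled by writing the operator as a product of two Hilbert–Schmidt operators
(`hasSum_trace_evalHS`). Differentiating the Gaussian yields `S = Σ + (i / 2) Θ` and Wick's formula
`E (ξ j ξ k ξ l ξ m) = S j k S l m + S j l S k m + S j m S k l`, and the formula for `Ψ` follows by
taking real parts and symmetrising.

Finally `S` is the Gram matrix of the vectors `D j F (0)`, so it is positive semidefinite. With
`S = Bᴴ B` and `Sᵀ = Cᴴ C` one has `⟨R, K (R)⟩ = Tr (R S R Sᵀ) = Tr (M Mᴴ)` for `M = C R Bᴴ`, which
is nonnegative, and which vanishes only for `R = 0` if `S`, and with it `B` and `C`, is invertible.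
-/

namespace QuantumGaussian

open Filter Topology
open scoped ContDiff ComplexOrder

/-! ### Smoothness of Hilbert space valued maps from their Gram kernel -/

/-- The mixed second difference quotients of a function of two real variables converge to its mixed
second derivative `c`, the two increments tending to zero independently. -/
theorem tendsto_mixed_difference_quotient {g a c : ℝ → ℝ → ℂ}
    (ha : ∀ s t, HasDerivAt (fun t => g s t) (a s t) t)
    (hc : ∀ s t, HasDerivAt (fun s => a s t) (c s t) s)
    (hcont : ContinuousAt (fun p : ℝ × ℝ => c p.1 p.2) 0) :
    Tendsto (fun p : ℝ × ℝ =>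
        ((p.1 : ℂ) * p.2)⁻¹ * (g p.1 p.2 - g p.1 0 - (g 0 p.2 - g 0 0)))
      (𝓝[≠] 0 ×ˢ 𝓝[≠] 0) (𝓝 (c 0 0)) := by
  rw [Metric.tendsto_nhds]
  intro ε hε
  obtain ⟨δ, hδ, hball⟩ := Metric.continuousAt_iff.1 hcont (ε / 2) (half_pos hε)
  have key : ∀ s ∈ Metric.ball (0 : ℝ) δ, ∀ t ∈ Metric.ball (0 : ℝ) δ,
      ‖c s t - c 0 0‖ ≤ ε / 2 := by
    intro s hs t ht
    have := hball (x := (s, t)) (by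
      rw [Prod.dist_eq]; exact max_lt hs ht)
    rw [dist_eq_norm] at this
    exact this.le
  have h0 : (0 : ℝ) ∈ Metric.ball (0 : ℝ) δ := Metric.mem_ball_self hδ
  -- The mean value inequality is applied first in the variable `s`, then in the variable `t`.
  have step1 : ∀ s ∈ Metric.ball (0 : ℝ) δ, ∀ t ∈ Metric.ball (0 : ℝ) δ,
      ‖a s t - a 0 t - s * c 0 0‖ ≤ ε / 2 * ‖s‖ := by
    intro s hs t ht
    have := (convex_ball (0 : ℝ) δ).norm_image_sub_le_of_norm_hasDerivWithin_le
      (f := fun s : ℝ => a s t - s * c 0 0) (f' := fun s => c s t - 1 * c 0 0) (C := ε / 2)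
      (fun x _ => ((hc x t).sub
        ((Complex.ofRealCLM.hasDerivAt (x := x)).mul_const _)).hasDerivWithinAt)
      (fun x hx => by simpa using key x hx t ht) h0 hs
    simp only [Complex.ofReal_zero, zero_mul, sub_zero] at this
    refine (congrArg _ ?_).trans_le this
    ring
  have step2 : ∀ s ∈ Metric.ball (0 : ℝ) δ, ∀ t ∈ Metric.ball (0 : ℝ) δ,
      ‖g s t - g s 0 - (g 0 t - g 0 0) - s * t * c 0 0‖ ≤ ε / 2 * ‖s‖ * ‖t‖ := by
    intro s hs t ht
    have := (convex_ball (0 : ℝ) δ).norm_image_sub_le_of_norm_hasDerivWithin_le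
      (f := fun t : ℝ => g s t - g 0 t - t * (s * c 0 0))
      (f' := fun t => a s t - a 0 t - 1 * (s * c 0 0)) (C := ε / 2 * ‖s‖)
      (fun x _ => (((ha s x).sub (ha 0 x)).sub
        ((Complex.ofRealCLM.hasDerivAt (x := x)).mul_const _)).hasDerivWithinAt)
      (fun x hx => by simpa using step1 s hs x hx) h0 ht
    simp only [Complex.ofReal_zero, zero_mul, sub_zero] at this
    refine (congrArg _ ?_).trans_le this
    ring
  have hev : ∀ᶠ s in 𝓝[≠] (0 : ℝ), s ∈ Metric.ball (0 : ℝ) δ ∧ s ≠ 0 :=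
    (eventually_nhdsWithin_of_eventually_nhds (Metric.ball_mem_nhds 0 hδ)).and
      self_mem_nhdsWithin
  filter_upwards [hev.prod_mk hev] with ⟨s, t⟩ ⟨⟨hs, hs0⟩, ht, ht0⟩
  have hst : (s : ℂ) * t ≠ 0 := by simpa using ⟨hs0, ht0⟩
  have hn : 0 < ‖s‖ * ‖t‖ := by positivity
  have e : ((s : ℂ) * t)⁻¹ * (g s t - g s 0 - (g 0 t - g 0 0)) - c 0 0
      = ((s : ℂ) * t)⁻¹ * (g s t - g s 0 - (g 0 t - g 0 0) - s * t * c 0 0) := by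
    rw [mul_sub _ _ (s * t * c 0 0), inv_mul_cancel_left₀ hst]
  rw [dist_eq_norm, e, norm_mul, norm_inv, norm_mul, Complex.norm_real, Complex.norm_real]
  calc _ ≤ (‖s‖ * ‖t‖)⁻¹ * (ε / 2 * ‖s‖ * ‖t‖) := by
        gcongr; exact step2 s hs t ht
    _ = ε / 2 := by field_simp
    _ < ε := half_lt_self hε

section Gram

variable {V : Type*} [NormedAddCommGroup V] [NormedSpace ℝ V]
  {E : Type*} [NormedAddCommGroup E] [InnerProductSpace ℂ E]

/-- The mixed second directional derivative of a kernel `K` on `V × V`, in the direction `w'` of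
the second variable and the direction `w` of the first. -/
noncomputable def mixedDeriv (K : V × V → ℂ) (w w' : V) (p : V × V) : ℂ :=
  fderiv ℝ (fun q => fderiv ℝ K q (0, w')) p (w, 0)

theorem contDiff_mixedDeriv {K : V × V → ℂ} (hK : ContDiff ℝ ∞ K) (w w' : V) :
    ContDiff ℝ ∞ (mixedDeriv K w w') :=
  ((hK.fderiv_right (m := ∞) le_rfl).clm_apply contDiff_const |>.fderiv_right
    (m := ∞) le_rfl).clm_apply contDiff_const

theorem mixedDeriv_add_right {K : V × V → ℂ} (hK : ContDiff ℝ ∞ K) (w w₁ w₂ : V) (p : V × V) :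
    mixedDeriv K w (w₁ + w₂) p = mixedDeriv K w w₁ p + mixedDeriv K w w₂ p := by
  have h : ∀ w' : V, DifferentiableAt ℝ (fun q => fderiv ℝ K q (0, w')) p := fun w' =>
    ((hK.fderiv_right (m := ∞) le_rfl).clm_apply contDiff_const).differentiable (by simp) p
  unfold mixedDeriv
  rw [← add_apply, ← fderiv_add (h w₁) (h w₂)]
  congr 2
  ext q
  rw [Pi.add_apply, ← map_add]
  simp

theorem mixedDeriv_smul_right {K : V × V → ℂ} (hK : ContDiff ℝ ∞ K) (w w' : V) (r : ℝ)
    (p : V × V) : mixedDeriv K w (r • w') p = r • mixedDeriv K w w' p := by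
  have h : DifferentiableAt ℝ (fun q => fderiv ℝ K q (0, w')) p :=
    ((hK.fderiv_right (m := ∞) le_rfl).clm_apply contDiff_const).differentiable (by simp) p
  unfold mixedDeriv
  rw [← smul_apply, ← fderiv_const_smul h]
  congr 2
  ext q
  rw [Pi.smul_apply, ← map_smul]
  simp

/-- The inner products of the difference quotients of `F` are mixed second difference quotients of
its Gram kernel, and so converge without any prior regularity of `F`. -/
theorem tendsto_inner_difference_quotients {F : V → E}
    (hK : ContDiff ℝ ∞ fun p : V × V => inner ℂ (F p.1) (F p.2)) (v u w w' : V) :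
    Tendsto (fun p : ℝ × ℝ => inner ℂ (p.1⁻¹ • (F (v + p.1 • w) - F v))
        (p.2⁻¹ • (F (u + p.2 • w') - F u)))
      (𝓝[≠] 0 ×ˢ 𝓝[≠] 0)
      (𝓝 (mixedDeriv (fun p : V × V => inner ℂ (F p.1) (F p.2)) w w' (v, u))) := by
  set K : V × V → ℂ := fun p => inner ℂ (F p.1) (F p.2) with hKdef
  have hline : ∀ s t : ℝ, HasDerivAt (fun t : ℝ => (v + s • w, u + t • w')) (0, w') t := by
    intro s t
    refine (hasDerivAt_const _ _).prodMk ?_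
    simpa using ((hasDerivAt_id t).smul_const w').const_add u
  have hline' : ∀ s t : ℝ, HasDerivAt (fun s : ℝ => (v + s • w, u + t • w')) (w, 0) s := by
    intro s t
    refine HasDerivAt.prodMk ?_ (hasDerivAt_const _ _)
    simpa using ((hasDerivAt_id s).smul_const w).const_add v
  have h := tendsto_mixed_difference_quotient
    (g := fun s t => K (v + s • w, u + t • w'))
    (a := fun s t => fderiv ℝ K (v + s • w, u + t • w') (0, w'))
    (c := fun s t => mixedDeriv K w w' (v + s • w, u + t • w'))
    (fun s t => ((hK.differentiable (by simp) _).hasFDerivAt).comp_hasDerivAt t (hline s t))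
    (fun s t => ((((hK.fderiv_right (m := ∞) le_rfl).clm_apply
      contDiff_const).differentiable (by simp) _).hasFDerivAt).comp_hasDerivAt s (hline' s t))
    (((contDiff_mixedDeriv hK w w').continuous.comp (by fun_prop)).continuousAt)
  simp only [zero_smul, add_zero] at h
  refine h.congr fun p => ?_
  simp only [hKdef, ← Complex.coe_smul, inner_smul_left, inner_smul_right, inner_sub_left,
    inner_sub_right, map_inv₀, Complex.conj_ofReal, Complex.ofReal_inv, mul_inv]
  ring

variable [CompleteSpace E]

/-- A map with a smooth Gram kernel has all directional derivatives: if `q` denotes its difference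
quotients, then the four terms of `⟪q s - q t, q s - q t⟫` have the same limit, so `q` is Cauchy. -/
theorem exists_hasDerivAt_of_contDiff_gram {F : V → E}
    (hK : ContDiff ℝ ∞ fun p : V × V => inner ℂ (F p.1) (F p.2)) (u w : V) :
    ∃ G, HasDerivAt (fun t : ℝ => F (u + t • w)) G 0 := by
  set q : ℝ → E := fun t => t⁻¹ • (F (u + t • w) - F u) with hq
  set l : Filter ℝ := 𝓝[≠] 0
  have h := tendsto_inner_difference_quotients hK u u w w
  set M := mixedDeriv (fun p : V × V => inner ℂ (F p.1) (F p.2)) w w (u, u)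
  have h12 : Tendsto (fun p : ℝ × ℝ => inner ℂ (q p.1) (q p.2)) (l ×ˢ l) (𝓝 M) := h
  have h21 : Tendsto (fun p : ℝ × ℝ => inner ℂ (q p.2) (q p.1)) (l ×ˢ l) (𝓝 M) :=
    h12.comp tendsto_prod_swap
  have hd : Tendsto (fun t : ℝ => inner ℂ (q t) (q t)) l (𝓝 M) :=
    h12.comp (tendsto_id.prodMk tendsto_id)
  have hdist : Tendsto (fun p : ℝ × ℝ => dist (q p.1) (q p.2)) (l ×ˢ l) (𝓝 0) := by
    have h2 : Tendsto (fun p : ℝ × ℝ => inner ℂ (q p.1 - q p.2) (q p.1 - q p.2)) (l ×ˢ l)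
        (𝓝 (M - M - (M - M))) := by
      simp only [inner_sub_left, inner_sub_right]
      exact ((hd.comp tendsto_fst).sub h21).sub (h12.sub (hd.comp tendsto_snd))
    have h3 := (Complex.continuous_re.tendsto _).comp h2
    have h4 := (Real.continuous_sqrt.tendsto _).comp h3
    simp only [sub_self, Complex.zero_re, Real.sqrt_zero] at h4
    refine h4.congr fun p => ?_
    rw [dist_eq_norm, @norm_eq_sqrt_re_inner ℂ]
    rfl
  have hc : Cauchy (map q l) := by
    rw [cauchy_map_iff]
    refine ⟨inferInstance, ?_⟩
    rw [Metric.uniformity_eq_comap_nhds_zero, tendsto_comap_iff]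
    exact hdist
  obtain ⟨G, hG⟩ := CompleteSpace.complete hc
  refine ⟨G, hasDerivAt_iff_tendsto_slope_zero.2 ?_⟩
  have : Tendsto q l (𝓝 G) := hG
  simpa [hq] using this

variable [FiniteDimensional ℝ V]

/-- A Hilbert space valued map is Fréchet differentiable if its Gram kernel is smooth, and the
Gram kernel of each of its directional derivatives is again smooth. -/
theorem differentiable_of_contDiff_gram {F : V → E}
    (hK : ContDiff ℝ ∞ fun p : V × V => inner ℂ (F p.1) (F p.2)) :
    Differentiable ℝ F ∧ ∀ w, ContDiff ℝ ∞
      fun p : V × V => inner ℂ (fderiv ℝ F p.1 w) (fderiv ℝ F p.2 w) := by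
  choose G hG using fun u w => exists_hasDerivAt_of_contDiff_gram hK u w
  have hgram : ∀ v u w w', inner ℂ (G v w) (G u w') =
      mixedDeriv (fun p : V × V => inner ℂ (F p.1) (F p.2)) w w' (v, u) := by
    intro v u w w'
    refine tendsto_nhds_unique ?_ (tendsto_inner_difference_quotients hK v u w w')
    have h1 := hasDerivAt_iff_tendsto_slope_zero.1 (hG v w)
    have h2 := hasDerivAt_iff_tendsto_slope_zero.1 (hG u w')
    simp only [zero_add, zero_smul, add_zero] at h1 h2
    exact (h1.comp tendsto_fst).inner (h2.comp tendsto_snd)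
  -- The directional derivative is linear in the direction, because its inner products with all
  -- directional derivatives are, and these include the vectors to be compared.
  have hadd : ∀ u w w', G u (w + w') = G u w + G u w' := by
    intro u w w'
    have h : ∀ w₀, inner ℂ (G u w₀) (G u (w + w') - (G u w + G u w')) = 0 := by
      intro w₀
      rw [inner_sub_right, inner_add_right]
      simp only [hgram, mixedDeriv_add_right hK]
      ring
    rw [← sub_eq_zero, ← inner_self_eq_zero (𝕜 := ℂ)]
    nth_rewrite 1 [inner_sub_left]
    rw [inner_add_left, h, h, h]
    simp
  have hsmul : ∀ u (r : ℝ) w, G u (r • w) = r • G u w := by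
    intro u r w
    have h : ∀ w₀, inner ℂ (G u w₀) (G u (r • w) - r • G u w) = 0 := by
      intro w₀
      rw [inner_sub_right, inner_smul_right_eq_smul]
      simp only [hgram, mixedDeriv_smul_right hK]
      ring
    rw [← sub_eq_zero, ← inner_self_eq_zero (𝕜 := ℂ)]
    nth_rewrite 1 [inner_sub_left]
    rw [inner_smul_left_eq_smul, h, h]
    simp
  let L : V → V →L[ℝ] E := fun u => LinearMap.toContinuousLinearMap
    { toFun := G u, map_add' := hadd u, map_smul' := fun r w => hsmul u r w }
  have hLapply : ∀ u w, L u w = G u w := fun _ _ => rfl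
  have hLcont : Continuous L := by
    rw [continuous_clm_apply]
    intro w
    simp only [hLapply]
    have hM := (contDiff_mixedDeriv hK w w).continuous
    rw [continuous_iff_continuousAt]
    intro u
    rw [ContinuousAt, tendsto_iff_norm_sub_tendsto_zero]
    have h2 : Tendsto (fun x => inner ℂ (G x w - G u w) (G x w - G u w)) (𝓝 u)
        (𝓝 (inner ℂ (G u w - G u w) (G u w - G u w))) := by
      simp only [inner_sub_left, inner_sub_right, hgram]
      refine Continuous.tendsto ?_ u
      fun_prop
    have h3 := (Complex.continuous_re.tendsto _).comp h2
    have h4 := (Real.continuous_sqrt.tendsto _).comp h3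
    simp only [sub_self, inner_zero_left, Complex.zero_re, Real.sqrt_zero] at h4
    refine h4.congr fun p => ?_
    rw [@norm_eq_sqrt_re_inner ℂ]
    rfl
  -- Directional derivatives which are linear in the direction and continuous in the base point form
  -- a Fréchet derivative, by the mean value inequality along segments.
  have hF : ∀ u, HasFDerivAt F (L u) u := by
    intro u
    rw [hasFDerivAt_iff_isLittleO_nhds_zero, Asymptotics.isLittleO_iff]
    intro ε hε
    obtain ⟨δ, hδ, hball⟩ := Metric.continuousAt_iff.1 hLcont.continuousAt ε hε
    filter_upwards [Metric.ball_mem_nhds (0 : V) hδ] with w hw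
    have hw' : ‖w‖ < δ := by simpa using hw
    have hder : ∀ t : ℝ, HasDerivAt (fun t : ℝ => F (u + t • w)) (G (u + t • w) w) t := by
      intro t
      have h := HasDerivAt.comp_sub_const (x := t) (a := t) (by simpa using hG (u + t • w) w)
      refine h.congr_of_eventuallyEq (Eventually.of_forall fun x => ?_)
      simp only
      congr 1
      rw [sub_smul]
      abel
    have := (convex_Icc (0 : ℝ) 1).norm_image_sub_le_of_norm_hasDerivWithin_le
      (f := fun t : ℝ => F (u + t • w) - t • L u w)
      (f' := fun t => G (u + t • w) w - (1 : ℝ) • L u w) (C := ε * ‖w‖)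
      (fun t _ => ((hder t).sub ((hasDerivAt_id t).smul_const _)).hasDerivWithinAt)
      (fun t ht => by
        have h1 : ‖L (u + t • w) - L u‖ ≤ ε := by
          rw [← dist_eq_norm]
          refine (hball ?_).le
          rw [dist_eq_norm, add_sub_cancel_left, norm_smul, Real.norm_of_nonneg ht.1]
          exact lt_of_le_of_lt (mul_le_of_le_one_left (norm_nonneg _) ht.2) hw'
        rw [one_smul, ← hLapply, ← sub_apply]
        exact ((L (u + t • w) - L u).le_opNorm w).trans (by gcongr))
      (Set.left_mem_Icc.2 zero_le_one) (Set.right_mem_Icc.2 zero_le_one)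
    simp only [one_smul, zero_smul, add_zero, sub_zero, norm_one, mul_one] at this
    convert this using 2
    abel
  refine ⟨fun u => (hF u).differentiableAt, fun w => ?_⟩
  simp only [fun u => (hF u).fderiv, hLapply, hgram]
  exact contDiff_mixedDeriv hK w w

/-- A map into a Hilbert space with a smooth Gram kernel is smooth. -/
theorem contDiff_of_contDiff_gram {F : V → E}
    (hK : ContDiff ℝ ∞ fun p : V × V => inner ℂ (F p.1) (F p.2)) : ContDiff ℝ ∞ F := by
  rw [contDiff_infty]
  intro m
  induction m generalizing F with
  | zero => exact contDiff_zero.2 (differentiable_of_contDiff_gram hK).1.continuous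
  | succ m ih =>
    obtain ⟨hd, hg⟩ := differentiable_of_contDiff_gram hK
    push_cast
    exact contDiff_succ_iff_fderiv_apply.2 ⟨hd, by simp, fun w => ih (hg w)⟩

end Gram

/-! ### Hilbert–Schmidt operators as square summable families -/

theorem memℓp_two_iff_summable_sq {H : Type*} [NormedAddCommGroup H] {ι : Type*} {f : ι → H} :
    Memℓp (E := fun _ => H) f 2 ↔ Summable fun i => ‖f i‖ ^ 2 := by
  rw [memℓp_gen_iff (by norm_num)]
  simp

theorem hasSum_lp_norm_sq {H : Type*} [NormedAddCommGroup H] {ι : Type*}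
    (f : lp (fun _ : ι => H) 2) : HasSum (fun i => ‖f i‖ ^ 2) (‖f‖ ^ 2) := by
  simpa using lp.hasSum_norm (p := 2) (by norm_num) f

section HilbertSchmidt

variable {H : Type*} [NormedAddCommGroup H] [InnerProductSpace ℂ H] {ι : Type*}

theorem hasSum_sq_norm_inner (b : HilbertBasis ι ℂ H) (x : H) :
    HasSum (fun i => ‖inner ℂ (b i) x‖ ^ 2) (‖x‖ ^ 2) := by
  have h := (b.hasSum_inner_mul_inner x x).mapL Complex.reCLM
  have e : Complex.reCLM (inner ℂ x x) = ‖x‖ ^ 2 := inner_self_eq_norm_sq (𝕜 := ℂ) x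
  rw [e] at h
  refine h.congr_fun fun i => ?_
  rw [← inner_conj_symm x (b i), ← Complex.normSq_eq_conj_mul_self, Complex.normSq_eq_norm_sq]
  exact (Complex.ofReal_re _).symm

theorem memℓp_rankOne (b : HilbertBasis ι ℂ H) (φ χ : H) :
    Memℓp (E := fun _ => H) (fun i => inner ℂ φ (b i) • χ) 2 := by
  rw [memℓp_two_iff_summable_sq]
  simp only [norm_smul, mul_pow, norm_inner_symm φ]
  exact (hasSum_sq_norm_inner b φ).summable.mul_right _

/-- For a Hilbert basis `b`, the rank one operator `α ↦ ⟪φ, α⟫ • χ` as an element of the space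
`ℓ²(ι, H)`. This space stands for the Hilbert–Schmidt operators `T` through `T ↦ (T (b i))ᵢ`. -/
noncomputable def rankOneHS (b : HilbertBasis ι ℂ H) (φ : H) :
    H →L[ℂ] lp (fun _ : ι => H) 2 :=
  LinearMap.mkContinuous
    { toFun := fun χ => ⟨fun i => inner ℂ φ (b i) • χ, memℓp_rankOne b φ χ⟩
      map_add' := fun χ χ' => by
        ext i
        exact smul_add _ _ _
      map_smul' := fun c χ => by
        ext i
        exact smul_comm _ _ _ } ‖φ‖ (by
    intro χ
    refine (pow_le_pow_iff_left₀ (norm_nonneg _) (by positivity) two_ne_zero).1 (le_of_eq ?_)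
    refine (hasSum_lp_norm_sq _).unique ?_
    rw [mul_pow]
    refine ((hasSum_sq_norm_inner b φ).mul_right (‖χ‖ ^ 2)).congr_fun fun i => ?_
    rw [← mul_pow, norm_inner_symm, ← norm_smul]
    rfl)

theorem rankOneHS_apply (b : HilbertBasis ι ℂ H) (φ χ : H) (i : ι) :
    rankOneHS b φ χ i = inner ℂ φ (b i) • χ := rfl

/-- A bounded operator `T` with `∑ ‖T (b i)‖² < ∞`, as an element of `ℓ²(ι, H)`. -/
noncomputable def toHS (b : HilbertBasis ι ℂ H) (T : H →L[ℂ] H)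
    (hT : Summable fun i => ‖T (b i)‖ ^ 2) :
    lp (fun _ : ι => H) 2 :=
  ⟨fun i => T (b i), memℓp_two_iff_summable_sq.2 hT⟩

theorem toHS_apply (b : HilbertBasis ι ℂ H) (T : H →L[ℂ] H)
    (hT : Summable fun i => ‖T (b i)‖ ^ 2) (i : ι) : toHS b T hT i = T (b i) := rfl

/-- The matrix coefficients of a Hilbert–Schmidt operator are square summable. -/
theorem summable_norm_sq_inner_lp (b : HilbertBasis ι ℂ H) (f : lp (fun _ : ι => H) 2) :
    Summable fun p : ι × ι => ‖inner ℂ (b p.2) (f p.1)‖ ^ 2 := by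
  refine (summable_prod_of_nonneg fun p => by positivity).2
    ⟨fun i => (hasSum_sq_norm_inner b (f i)).summable, ?_⟩
  simp only [fun i => (hasSum_sq_norm_inner b (f i)).tsum_eq]
  exact (hasSum_lp_norm_sq f).summable

variable [CompleteSpace H]

/-- The value at `φ` of the Hilbert–Schmidt operator given by an element of `ℓ²(ι, H)`. -/
noncomputable def evalHS (b : HilbertBasis ι ℂ H) (φ : H) : lp (fun _ : ι => H) 2 →L[ℂ] H :=
  (rankOneHS b φ).adjoint

theorem hasSum_inner_evalHS (b : HilbertBasis ι ℂ H) (φ χ : H) (G : lp (fun _ : ι => H) 2) :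
    HasSum (fun i => inner ℂ (b i) φ * inner ℂ χ (G i)) (inner ℂ χ (evalHS b φ G)) := by
  rw [evalHS, ContinuousLinearMap.adjoint_inner_right]
  refine (lp.hasSum_inner _ _).congr_fun fun i => ?_
  rw [rankOneHS_apply, inner_smul_left, inner_conj_symm]

theorem evalHS_basis (b : HilbertBasis ι ℂ H) (i : ι) (G : lp (fun _ : ι => H) 2) :
    evalHS b (b i) G = G i := by
  refine ext_inner_left ℂ fun χ => (hasSum_inner_evalHS b (b i) χ G).unique ?_
  convert hasSum_single i fun j hj => ?_ using 1
  · simp [b.orthonormal.1 i]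
  · rw [b.orthonormal.2 hj, zero_mul]

theorem evalHS_toHS (b : HilbertBasis ι ℂ H) (T : H →L[ℂ] H)
    (hT : Summable fun i => ‖T (b i)‖ ^ 2) (φ : H) : evalHS b φ (toHS b T hT) = T φ := by
  refine ext_inner_left ℂ fun χ => (hasSum_inner_evalHS b φ χ _).unique ?_
  refine (((b.hasSum_repr φ).mapL T).mapL (innerSL ℂ χ)).congr_fun fun i => ?_
  rw [b.repr_apply_apply, map_smul, map_smul, toHS_apply]
  rfl

/-- The trace formula `Tr (G s) = ⟪s, G⟫` for Hilbert–Schmidt operators `s = s†` and `G`, with an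
unconditionally convergent diagonal sum of `G s`. -/
theorem hasSum_trace_evalHS (b : HilbertBasis ι ℂ H) (s : H →L[ℂ] H) (hs : IsSelfAdjoint s)
    (hT : Summable fun i => ‖s (b i)‖ ^ 2) (G : lp (fun _ : ι => H) 2) :
    HasSum (fun i => inner ℂ (b i) (evalHS b (s (b i)) G)) (inner ℂ (toHS b s hT) G) := by
  have hadj : ∀ x y, inner ℂ x (s y) = inner ℂ (s x) y := fun x y =>
    (hs.isSymmetric x y).symm
  -- Both sides are iterated sums of the absolutely summable family `f`, in the two possible orders.
  set f : ι × ι → ℂ := fun p => inner ℂ (s (b p.1)) (b p.2) * inner ℂ (b p.2) (G p.1) with hf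
  have hsum : Summable f := by
    refine Summable.of_norm_bounded
      ((summable_norm_sq_inner_lp b (toHS b s hT)).add (summable_norm_sq_inner_lp b G))
      fun p => ?_
    rw [hf, norm_mul, norm_inner_symm, toHS_apply]
    nlinarith [sq_nonneg (‖inner ℂ (b p.2) (s (b p.1))‖ - ‖inner ℂ (b p.2) (G p.1)‖),
      sq_nonneg ‖inner ℂ (b p.2) (s (b p.1))‖, sq_nonneg ‖inner ℂ (b p.2) (G p.1)‖]
  have h1 : HasSum (fun j => inner ℂ (toHS b s hT j) (G j)) (∑' p, f p) :=
    hsum.hasSum.prod_fiberwise fun j => b.hasSum_inner_mul_inner (s (b j)) (G j)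
  rw [(lp.hasSum_inner (toHS b s hT) G).unique h1]
  refine ((Equiv.prodComm ι ι).hasSum_iff.2 hsum.hasSum).prod_fiberwise fun i => ?_
  refine (hasSum_inner_evalHS b (s (b i)) (b i) G).congr_fun fun j => ?_
  rw [hadj]
  rfl

end HilbertSchmidt

/-! ### Unbounded operators, their graphs and expectations -/

section Graphs

variable {H : Type u} [NormedAddCommGroup H] [InnerProductSpace ℂ H]

theorem mem_graph_opMul {A B : H →ₗ.[ℂ] H} {ψ χ φ : H} (hB : (ψ, χ) ∈ B.graph)
    (hA : (χ, φ) ∈ A.graph) : (ψ, φ) ∈ (opMul A B).graph := by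
  rw [LinearPMap.mem_graph_iff] at hA hB ⊢
  obtain ⟨⟨ψ, hψ⟩, rfl, rfl⟩ := hB
  obtain ⟨⟨χ, hχ⟩, h1, h2⟩ := hA
  dsimp only at h1 h2
  subst h1 h2
  exact ⟨⟨ψ, ⟨ψ, hψ⟩, hχ, rfl⟩, rfl, rfl⟩

theorem mem_graph_sub_scalarOp {A : H →ₗ.[ℂ] H} {c : ℂ} {ψ φ : H} :
    (ψ, φ) ∈ (A - scalarOp c).graph ↔ (ψ, φ + c • ψ) ∈ A.graph := by
  rw [LinearPMap.mem_graph_iff, LinearPMap.mem_graph_iff]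
  constructor
  · rintro ⟨⟨ψ, hψ⟩, rfl, rfl⟩
    refine ⟨⟨ψ, hψ.1⟩, rfl, ?_⟩
    rw [LinearPMap.sub_apply]
    exact (sub_add_cancel _ _).symm
  · rintro ⟨⟨ψ, hψ⟩, rfl, h⟩
    refine ⟨⟨ψ, hψ, trivial⟩, rfl, ?_⟩
    rw [LinearPMap.sub_apply]
    exact sub_eq_of_eq_add h

theorem isClosed_graph_sub_scalarOp {A : H →ₗ.[ℂ] H} (hA : A.IsClosed) (c : ℂ) :
    IsClosed ((A - scalarOp c).graph : Set (H × H)) := by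
  have : ((A - scalarOp c).graph : Set (H × H)) =
      (fun p : H × H => (p.1, p.2 + c • p.1)) ⁻¹' (A.graph : Set (H × H)) := by
    ext ⟨ψ, φ⟩
    exact mem_graph_sub_scalarOp
  rw [this]
  exact IsClosed.preimage (by fun_prop) hA

theorem exists_of_mem_graph_sum {ι : Type*} (s : Finset ι) (A : ι → H →ₗ.[ℂ] H) {ψ φ : H}
    (h : (ψ, φ) ∈ (∑ j ∈ s, A j).graph) :
    ∃ g : ι → H, (∀ j ∈ s, (ψ, g j) ∈ (A j).graph) ∧ φ = ∑ j ∈ s, g j := by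
  classical
  induction s using Finset.induction_on generalizing φ with
  | empty =>
    refine ⟨0, by simp, ?_⟩
    rw [Finset.sum_empty, LinearPMap.mem_graph_iff] at h
    obtain ⟨y, -, hy⟩ := h
    exact hy.symm
  | insert a s ha ih =>
    rw [Finset.sum_insert ha, LinearPMap.mem_graph_iff] at h
    obtain ⟨⟨ψ, hψ⟩, rfl, rfl⟩ := h
    obtain ⟨g, hg, hsum⟩ := ih (LinearPMap.mem_graph _ ⟨ψ, hψ.2⟩)
    refine ⟨Function.update g a (A a ⟨ψ, hψ.1⟩), ?_, ?_⟩
    · intro j hj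
      by_cases hja : j = a
      · subst hja
        rw [Function.update_self]
        exact LinearPMap.mem_graph _ ⟨ψ, hψ.1⟩
      · rw [Function.update_of_ne hja]
        exact hg j (Finset.mem_of_mem_insert_of_ne hj hja)
    · rw [Finset.sum_insert ha, Function.update_self, LinearPMap.add_apply, hsum]
      congr 1
      refine Finset.sum_congr rfl fun j hj => ?_
      rw [Function.update_of_ne (ne_of_mem_of_not_mem hj ha)]

/-- The vanishing summands of `linComb` still restrict its domain, so that there is an inclusion
only. -/
theorem linComb_single_le {n : ℕ} (x : Fin n → H →ₗ.[ℂ] H) (j : Fin n) :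
    linComb (Pi.single j 1) x ≤ x j := by
  refine LinearPMap.le_of_le_graph ?_
  rintro ⟨ψ, φ⟩ h
  obtain ⟨g, hg, rfl⟩ := exists_of_mem_graph_sum _ _ h
  have hk : ∀ k, ∃ y : (x k).domain, (y : H) = ψ ∧
      g k = ((Pi.single j 1 : Fin n → ℝ) k : ℂ) • x k y := by
    intro k
    obtain ⟨⟨ψ, hψ⟩, rfl, h2⟩ := LinearPMap.mem_graph_iff _ |>.1 (hg k (Finset.mem_univ k))
    exact ⟨⟨ψ, hψ⟩, rfl, h2.symm⟩
  rw [Finset.sum_eq_single j]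
  · obtain ⟨y, rfl, h2⟩ := hk j
    rw [h2]
    simp
  · intro k _ hkj
    obtain ⟨y, rfl, h2⟩ := hk k
    rw [h2]
    simp [hkj]
  · simp

theorem HasTrace.unique {T : H → H} {c c' : ℂ} [CompleteSpace H] (h : HasTrace T c)
    (h' : HasTrace T c') : c = c' := by
  obtain ⟨w, b, -⟩ := exists_hilbertBasis ℂ H
  exact (h w b).unique (h' w b)

theorem HasExpectation.expectation_eq [CompleteSpace H] {ρ : H →L[ℂ] H} {A : H →ₗ.[ℂ] H} {c : ℂ}
    (h : HasExpectation ρ A c) : expectation ρ A = c := by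
  have hex : ∃ c, HasExpectation ρ A c := ⟨c, h⟩
  rw [expectation, dif_pos hex]
  obtain ⟨_, h1⟩ := h
  obtain ⟨_, h2⟩ := hex.choose_spec
  exact h2.unique h1

theorem HasExpectation.of_mem_graph {ρ : H →L[ℂ] H} {A : H →ₗ.[ℂ] H} {c : ℂ} {T : H → H}
    (hT : ∀ ψ, (ρ ψ, T ψ) ∈ A.graph) (h : HasTrace T c) : HasExpectation ρ A c := by
  have hd : ∀ ψ, ∃ h : ρ ψ ∈ A.domain, A ⟨ρ ψ, h⟩ = T ψ := by
    intro ψ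
    obtain ⟨y, h1, h2⟩ := LinearPMap.mem_graph_iff _ |>.1 (hT ψ)
    dsimp only at h1 h2
    exact ⟨h1 ▸ y.2, by rw [← h2]; congr 1; exact Subtype.ext h1.symm⟩
  choose h1 h2 using hd
  exact ⟨h1, by simpa only [h2] using h⟩

/-- To show that an expectation exists it suffices to find, for each Hilbert basis, a possibly
different witness for the operator `A ρ`, since `A` determines `A ρ`. -/
theorem HasExpectation.of_forall_hilbertBasis [CompleteSpace H] {ρ : H →L[ℂ] H}
    {A : H →ₗ.[ℂ] H} {c : ℂ}
    (h : ∀ (ι : Type u) (b : HilbertBasis ι ℂ H), ∃ T : H → H,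
      (∀ ψ, (ρ ψ, T ψ) ∈ A.graph) ∧ HasSum (fun i => inner ℂ (b i) (T (b i))) c) :
    HasExpectation ρ A c := by
  obtain ⟨w, b, -⟩ := exists_hilbertBasis ℂ H
  obtain ⟨T, hT, -⟩ := h w b
  refine HasExpectation.of_mem_graph hT fun ι b' => ?_
  obtain ⟨T', hT', hsum⟩ := h ι b'
  refine hsum.congr_fun fun i => ?_
  rw [A.mem_graph_snd_inj (hT _) (hT' _) rfl]

theorem inner_eq_of_mem_graph_of_isSelfAdjoint [CompleteSpace H] {A : H →ₗ.[ℂ] H}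
    (hA : IsSelfAdjoint A) {ψ φ ψ' φ' : H} (h : (ψ, φ) ∈ A.graph) (h' : (ψ', φ') ∈ A.graph) :
    inner ℂ φ ψ' = inner ℂ ψ φ' := by
  have := LinearPMap.adjoint_isFormalAdjoint hA.dense_domain
  rw [LinearPMap.isSelfAdjoint_def.1 hA] at this
  obtain ⟨y, rfl, rfl⟩ := LinearPMap.mem_graph_iff _ |>.1 h
  obtain ⟨y', rfl, rfl⟩ := LinearPMap.mem_graph_iff _ |>.1 h'
  exact this y y'

theorem mem_graph_sub_scalarOp_inner_eq [CompleteSpace H] {A : H →ₗ.[ℂ] H}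
    (hA : IsSelfAdjoint A) {c : ℂ} (hc : c.im = 0) {ψ φ ψ' φ' : H}
    (h : (ψ, φ) ∈ (A - scalarOp c).graph)
    (h' : (ψ', φ') ∈ (A - scalarOp c).graph) : inner ℂ φ ψ' = inner ℂ ψ φ' := by
  have := inner_eq_of_mem_graph_of_isSelfAdjoint hA (mem_graph_sub_scalarOp.1 h)
    (mem_graph_sub_scalarOp.1 h')
  rw [inner_add_left, inner_add_right, inner_smul_left, inner_smul_right,
    Complex.conj_eq_iff_im.2 hc] at this
  exact add_right_cancel this

end Graphs

/-! ### The differential operators representing the observables -/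

section MomentDeriv

variable {n : ℕ} {E E' : Type*} [NormedAddCommGroup E] [NormedSpace ℂ E]
  [NormedAddCommGroup E'] [NormedSpace ℂ E']

/-- The first order differential operator `D j G (u) = -i ∂ⱼ G (u) - ½ (Θ u)ⱼ G (u)`, which
represents `ξ j` on the maps `u ↦ exp (i uᵀ ξ) ψ`. -/
noncomputable def momentDeriv (Θ : Matrix (Fin n) (Fin n) ℝ) (j : Fin n) (G : (Fin n → ℝ) → E)
    (u : Fin n → ℝ) : E :=
  -Complex.I • fderiv ℝ G u (Pi.single j 1) - (((Θ *ᵥ u) j / 2 : ℝ) : ℂ) • G u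

variable (Θ : Matrix (Fin n) (Fin n) ℝ) (j : Fin n)

theorem contDiff_momentDeriv {G : (Fin n → ℝ) → E} (hG : ContDiff ℝ ∞ G) :
    ContDiff ℝ ∞ (momentDeriv Θ j G) := by
  have h1 : ContDiff ℝ ∞ fun u => fderiv ℝ G u (Pi.single j 1) :=
    (hG.fderiv_right (m := ∞) le_rfl).clm_apply contDiff_const
  have h2 : ContDiff ℝ ∞ fun u : Fin n → ℝ => (((Θ *ᵥ u) j / 2 : ℝ) : ℂ) := by
    refine Complex.ofRealCLM.contDiff.comp (ContDiff.div_const ?_ 2)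
    simp only [Matrix.mulVec, dotProduct]
    fun_prop
  exact (h1.const_smul (-Complex.I)).sub (h2.smul hG)

theorem momentDeriv_comp (L : E →L[ℂ] E') {G : (Fin n → ℝ) → E} (hG : Differentiable ℝ G)
    (u : Fin n → ℝ) : momentDeriv Θ j (fun u => L (G u)) u = L (momentDeriv Θ j G u) := by
  have h : HasFDerivAt (fun u => L (G u)) ((L.restrictScalars ℝ).comp (fderiv ℝ G u)) u :=
    (L.restrictScalars ℝ).hasFDerivAt.comp u (hG u).hasFDerivAt
  rw [momentDeriv, momentDeriv, h.fderiv, map_sub, map_smul, map_smul]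
  rfl

theorem hasDerivAt_line {G : (Fin n → ℝ) → E} (hG : Differentiable ℝ G) (u w : Fin n → ℝ) :
    HasDerivAt (fun t : ℝ => G (u + t • w)) (fderiv ℝ G u w) 0 := by
  have h1 : HasDerivAt (fun t : ℝ => u + t • w) w 0 := by
    simpa using ((hasDerivAt_id (0 : ℝ)).smul_const w).const_add u
  have h2 : HasFDerivAt G (fderiv ℝ G u) (u + (0 : ℝ) • w) := by
    simpa using (hG u).hasFDerivAt
  exact h2.comp_hasDerivAt 0 h1

/-- The derivatives of a map with values in a closed subspace have values in it. Applied to the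
graph of a closed operator, this says that the operator commutes with differentiation. -/
theorem fderiv_mem_of_isClosed {M : Submodule ℂ E} (hM : IsClosed (M : Set E))
    {G : (Fin n → ℝ) → E} (hG : Differentiable ℝ G) (h : ∀ u, G u ∈ M) (u w : Fin n → ℝ) :
    fderiv ℝ G u w ∈ M := by
  refine hM.mem_of_tendsto (hasDerivAt_iff_tendsto_slope_zero.1 (hasDerivAt_line hG u w))
    (Eventually.of_forall fun t => ?_)
  rw [← Complex.coe_smul]
  exact M.smul_mem _ (M.sub_mem (h _) (h _))

theorem momentDeriv_mem_of_isClosed {M : Submodule ℂ (E × E')} (hM : IsClosed (M : Set (E × E')))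
    {G : (Fin n → ℝ) → E} {G' : (Fin n → ℝ) → E'} (hG : Differentiable ℝ G)
    (hG' : Differentiable ℝ G') (h : ∀ u, (G u, G' u) ∈ M) (u : Fin n → ℝ) :
    (momentDeriv Θ j G u, momentDeriv Θ j G' u) ∈ M := by
  have h1 := fderiv_mem_of_isClosed hM (hG.prodMk hG') h u (Pi.single j 1)
  rw [DifferentiableAt.fderiv_prodMk (hG u) (hG' u)] at h1
  exact M.sub_mem (M.smul_mem (-Complex.I) h1)
    (M.smul_mem (((Θ *ᵥ u) j / 2 : ℝ) : ℂ) (h u))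

theorem momentDeriv_eq_of_hasDerivAt {G : (Fin n → ℝ) → E} (hG : Differentiable ℝ G)
    {u : Fin n → ℝ} {G' : E} (h : HasDerivAt (fun t : ℝ => G (u + t • Pi.single j 1)) G' 0) :
    momentDeriv Θ j G u = -Complex.I • G' - (((Θ *ᵥ u) j / 2 : ℝ) : ℂ) • G u := by
  rw [momentDeriv, (hasDerivAt_line hG u _).unique h]

end MomentDeriv

/-! ### Square roots of density operators and the centered Weyl operators -/

theorem summable_mul_sqrt {H : Type*} [NormedAddCommGroup H] [InnerProductSpace ℂ H] {ι : Type*}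
    (b : HilbertBasis ι ℂ H) {s : H →L[ℂ] H} (hT : Summable fun i => ‖s (b i)‖ ^ 2)
    (T : H →L[ℂ] H) : Summable fun i => ‖(T * s) (b i)‖ ^ 2 := by
  refine Summable.of_nonneg_of_le (fun i => by positivity) (fun i => ?_) (hT.mul_left (‖T‖ ^ 2))
  rw [← mul_pow]
  exact pow_le_pow_left₀ (norm_nonneg _) (T.le_opNorm _) 2

section SquareRoot

variable {H : Type u} [NormedAddCommGroup H] [InnerProductSpace ℂ H] [CompleteSpace H]

theorem exists_selfAdjoint_sqrt {ρ : H →L[ℂ] H} (hρ : ρ.IsPositive) :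
    ∃ s : H →L[ℂ] H, IsSelfAdjoint s ∧ s * s = ρ :=
  have h : 0 ≤ ρ := (ContinuousLinearMap.nonneg_iff_isPositive ρ).2 hρ
  ⟨CFC.sqrt ρ, (CFC.sqrt_nonneg ρ).isSelfAdjoint, CFC.sqrt_mul_sqrt_self ρ h⟩

variable {ι : Type u} (b : HilbertBasis ι ℂ H) {ρ s : H →L[ℂ] H}

theorem summable_sqrt_of_isDensityOperator (hρ : IsDensityOperator ρ) (hs : IsSelfAdjoint s)
    (hss : s * s = ρ) : Summable fun i => ‖s (b i)‖ ^ 2 := by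
  refine (((hρ.2 ι b).mapL Complex.reCLM).congr_fun fun i => ?_).summable
  have h : inner ℂ (b i) (ρ (b i)) = inner ℂ (s (b i)) (s (b i)) := by
    rw [← hss]
    exact (hs.isSymmetric _ _).symm
  rw [h]
  exact (inner_self_eq_norm_sq (𝕜 := ℂ) _).symm

/-- `⟪s, T s⟫ = Tr (T ρ)` in the Hilbert–Schmidt space, where `s² = ρ`. -/
theorem inner_toHS_of_hasTrace (hs : IsSelfAdjoint s) (hss : s * s = ρ)
    (hT : Summable fun i => ‖s (b i)‖ ^ 2) {T : H →L[ℂ] H} {c : ℂ}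
    (h : HasTrace (fun ψ => T (ρ ψ)) c) :
    inner ℂ (toHS b s hT) (toHS b (T * s) (summable_mul_sqrt b hT T)) = c := by
  refine (hasSum_trace_evalHS b s hs hT _).unique ?_
  subst hss
  simp only [evalHS_toHS]
  exact h ι b

end SquareRoot

namespace CanonicalSystem

variable {n : ℕ} {H : Type u} [NormedAddCommGroup H] [InnerProductSpace ℂ H] [CompleteSpace H]
  (sys : CanonicalSystem n H) {ρ : H →L[ℂ] H}

theorem W_zero : sys.W 0 = 1 := by
  simpa using (sys.exp_W 0).zero

theorem dotProduct_Θ_self (u : Fin n → ℝ) : u ⬝ᵥ (sys.Θ *ᵥ u) = 0 := by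
  have h : u ⬝ᵥ (sys.Θ *ᵥ u) = u ⬝ᵥ (sys.Θᵀ *ᵥ u) := by
    rw [Matrix.mulVec_transpose, Matrix.dotProduct_mulVec, dotProduct_comm]
  rw [sys.antisymm, Matrix.neg_mulVec, dotProduct_neg] at h
  linarith

theorem W_neg_mul_self (u : Fin n → ℝ) : sys.W (-u) * sys.W u = 1 := by
  rw [sys.weyl, neg_dotProduct, dotProduct_Θ_self, neg_add_cancel, W_zero]
  simp

theorem star_W (u : Fin n → ℝ) : star (sys.W u) = sys.W (-u) := by
  have h := (sys.exp_W u).unitary 1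
  rw [one_smul] at h
  calc star (sys.W u) = (sys.W (-u) * sys.W u) * star (sys.W u) := by
        rw [W_neg_mul_self, one_mul]
    _ = sys.W (-u) := by rw [mul_assoc, Unitary.mul_star_self_of_mem h, mul_one]

/-- The generator of `t ↦ exp (i t x j)` is contained in `x j`: it is the closure of the restriction
of `x j` to the common domain of the observables, and `x j` is closed. -/
theorem mem_graph_x_of_hasDerivAt (j : Fin n) {ψ φ : H}
    (h : HasDerivAt (fun t : ℝ => sys.W (t • Pi.single j 1) ψ) (Complex.I • φ) 0) :
    (ψ, φ) ∈ (sys.x j).graph := by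
  have h1 := ((sys.exp_W (Pi.single j 1)).generator ψ φ).2 h
  have hcl := (sys.selfAdjoint j).isClosed
  have h2 := hcl.isClosable.closure_mono (linComb_single_le sys.x j)
  have h3 : (sys.x j).closure.graph = (sys.x j).graph := by
    rw [← hcl.isClosable.graph_closure_eq_closure_graph]
    exact hcl.submodule_topologicalClosure_eq
  rw [← h3]
  exact LinearPMap.le_graph_of_le h2 h1

variable {sys}

/-- The means of the observables are real: the characteristic function takes conjugate values
at `u` and `-u`, which forces `exp (i uᵀ E x)` to have modulus one. -/
theorem IsGaussian.mean_im (hG : sys.IsGaussian ρ) (hρ : IsDensityOperator ρ) (j : Fin n) :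
    (expectation ρ (sys.x j)).im = 0 := by
  obtain ⟨s, hs, hss⟩ := exists_selfAdjoint_sqrt hρ.1
  obtain ⟨w, b, -⟩ := exists_hilbertBasis ℂ H
  have hT := summable_sqrt_of_isDensityOperator b hρ hs hss
  have key : ∀ u : Fin n → ℝ,
      inner ℂ (toHS b s hT) (toHS b (sys.W u * s) (summable_mul_sqrt b hT _)) =
      Complex.exp (Complex.I * ∑ j, (u j : ℂ) * expectation ρ (sys.x j)) *
        Complex.exp (-((u ⬝ᵥ (sys.Sig ρ *ᵥ u) : ℝ) : ℂ) / 2) := by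
    intro u
    refine inner_toHS_of_hasTrace b hs hss hT ?_
    obtain ⟨h0, h⟩ := hG.charFun u
    intro κ b'
    refine ((h κ b').mul_left
      (Complex.exp (Complex.I * ∑ j, (u j : ℂ) * expectation ρ (sys.x j)))).congr_fun fun i => ?_
    change _ = _ * inner ℂ (b' i) (sys.centeredW ρ u (ρ (b' i)))
    rw [centeredW, smul_apply, inner_smul_right, ← mul_assoc, ← Complex.exp_add]
    simp
  have hconj : ∀ u : Fin n → ℝ,
      inner ℂ (toHS b s hT) (toHS b (sys.W (-u) * s) (summable_mul_sqrt b hT _)) =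
      (starRingEnd ℂ)
        (inner ℂ (toHS b s hT) (toHS b (sys.W u * s) (summable_mul_sqrt b hT _))) := by
    intro u
    rw [inner_conj_symm]
    refine (lp.hasSum_inner _ _).unique ((lp.hasSum_inner _ _).congr_fun fun i => ?_)
    simp only [toHS_apply, mul_apply_eq_comp]
    rw [← star_W, ContinuousLinearMap.star_eq_adjoint, ContinuousLinearMap.adjoint_inner_right]
  have h := congrArg norm (hconj (Pi.single j 1))
  rw [RCLike.norm_conj, key, key, norm_mul, norm_mul] at h
  simp only [Matrix.mulVec_neg, neg_dotProduct_neg] at h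
  have h2 := mul_right_cancel₀ (norm_ne_zero_iff.2 (Complex.exp_ne_zero _)) h
  simp only [Complex.norm_exp, Real.exp_eq_exp] at h2
  simp [Pi.single_apply] at h2
  linarith

theorem centeredW_mul (u v : Fin n → ℝ) : sys.centeredW ρ u * sys.centeredW ρ v =
    Complex.exp (-(Complex.I / 2) * ((u ⬝ᵥ (sys.Θ *ᵥ v) : ℝ) : ℂ)) • sys.centeredW ρ (u + v) := by
  simp only [centeredW]
  rw [smul_mul_smul_comm, sys.weyl, smul_smul, smul_smul, ← Complex.exp_add, ← Complex.exp_add,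
    ← Complex.exp_add]
  congr 2
  simp only [Pi.add_apply, Complex.ofReal_add, add_mul, Finset.sum_add_distrib]
  ring

theorem centeredW_zero : sys.centeredW ρ 0 = 1 := by
  simp [centeredW, W_zero]

/-- The centered Weyl operators are unitary only because the means are real. -/
theorem star_centeredW (hm : ∀ j, (expectation ρ (sys.x j)).im = 0) (u : Fin n → ℝ) :
    star (sys.centeredW ρ u) = sys.centeredW ρ (-u) := by
  have hm' : ∀ j, (starRingEnd ℂ) (expectation ρ (sys.x j)) = expectation ρ (sys.x j) :=
    fun j => Complex.conj_eq_iff_im.2 (hm j)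
  rw [centeredW, centeredW, star_smul, star_W]
  congr 1
  rw [← starRingEnd_apply, ← Complex.exp_conj]
  simp [hm']

theorem isClosed_graph_ξ (j : Fin n) : IsClosed ((sys.ξ ρ j).graph : Set (H × H)) :=
  isClosed_graph_sub_scalarOp (sys.selfAdjoint j).isClosed _

/-- On smooth orbits `u ↦ exp (i uᵀ ξ) ψ` the operator `ξ j` acts as `D j`. -/
theorem mem_graph_ξ_of_differentiable (j : Fin n) {ψ : H}
    (hψ : Differentiable ℝ fun u => sys.centeredW ρ u ψ) (u : Fin n → ℝ) :
    (sys.centeredW ρ u ψ, momentDeriv sys.Θ j (fun u => sys.centeredW ρ u ψ) u) ∈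
      (sys.ξ ρ j).graph := by
  refine mem_graph_sub_scalarOp.2 (sys.mem_graph_x_of_hasDerivAt j ?_)
  set m := expectation ρ (sys.x j) with hm
  have h1 : ∀ t : ℝ, sys.W (t • Pi.single j 1) (sys.centeredW ρ u ψ) =
      Complex.exp (t * (Complex.I * m - Complex.I / 2 * ((sys.Θ *ᵥ u) j : ℝ))) •
        sys.centeredW ρ (u + t • Pi.single j 1) ψ := by
    intro t
    have h2 : sys.W (t • Pi.single j 1) = Complex.exp (t * (Complex.I * m)) •
        sys.centeredW ρ (t • Pi.single j 1) := by
      have h3 : ∑ k, (((t • Pi.single j 1 : Fin n → ℝ) k : ℝ) : ℂ) * expectation ρ (sys.x k) =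
          t * m := by
        rw [Finset.sum_eq_single j (fun k _ hk => by simp [hk]) (by simp)]
        simp [hm]
      rw [centeredW, smul_smul, ← Complex.exp_add, h3]
      ring_nf
      simp
    rw [h2, smul_apply, ← mul_apply_eq_comp, centeredW_mul, smul_apply, smul_smul,
      ← Complex.exp_add, add_comm u]
    congr 2
    simp
    ring
  simp only [h1]
  have h3 : HasDerivAt
      (fun t : ℝ => Complex.exp (t * (Complex.I * m - Complex.I / 2 * ((sys.Θ *ᵥ u) j : ℝ))))
      (Complex.I * m - Complex.I / 2 * ((sys.Θ *ᵥ u) j : ℝ)) 0 := by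
    simpa using ((Complex.ofRealCLM.hasDerivAt (x := 0)).mul_const
      (Complex.I * m - Complex.I / 2 * ((sys.Θ *ᵥ u) j : ℝ))).cexp
  refine (h3.smul (hasDerivAt_line hψ u (Pi.single j 1))).congr_deriv ?_
  have hI : Complex.I * -Complex.I = 1 := by simp
  simp only [momentDeriv, Complex.ofReal_zero, zero_mul, Complex.exp_zero, one_smul, zero_smul,
    add_zero, smul_add, smul_sub, smul_smul, hI]
  push_cast
  module

end CanonicalSystem

/-! ### Moments of a Gaussian characteristic function -/

theorem contDiff_dotProduct_mulVec {n : ℕ} {V : Type*} [NormedAddCommGroup V] [NormedSpace ℝ V]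
    (M : Matrix (Fin n) (Fin n) ℝ) {f g : V → Fin n → ℝ} (hf : ContDiff ℝ ∞ f)
    (hg : ContDiff ℝ ∞ g) : ContDiff ℝ ∞ fun p => f p ⬝ᵥ (M *ᵥ g p) :=
  have h : ∀ i, ContDiff ℝ ∞ fun p => ∑ j, M i j * g p j := fun _ =>
    ContDiff.sum fun j _ => contDiff_const.mul (contDiff_pi.1 hg j)
  ContDiff.sum fun i _ => (contDiff_pi.1 hf i).mul (h i)

section Wick

variable {n : ℕ} (A Θ : Matrix (Fin n) (Fin n) ℝ)

/-- The Gaussian characteristic function `exp (-uᵀ A u / 2)`. -/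
noncomputable def gaussianCharFun (u : Fin n → ℝ) : ℂ :=
  Complex.exp (-((u ⬝ᵥ (A *ᵥ u) : ℝ) : ℂ) / 2)

/-- The complex covariance matrix `(A + Aᵀ) / 2 + (i / 2) Θ` of a Gaussian state; only the
symmetric part of `A` enters the characteristic function `exp (-uᵀ A u / 2)`. -/
noncomputable def gaussianCov (j k : Fin n) : ℂ :=
  ((A j k + A k j) / 2 : ℝ) + Complex.I / 2 * Θ j k

/-- The linear form `i (S u)ⱼ`, the factor which `D j` produces from the Gaussian characteristic
function. -/
noncomputable def gaussianLin (j : Fin n) (u : Fin n → ℝ) : ℂ :=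
  Complex.I * ∑ a, gaussianCov A Θ j a * u a

theorem contDiff_gaussianCharFun : ContDiff ℝ ∞ (gaussianCharFun A) := by
  exact ContDiff.cexp (ContDiff.div_const (ContDiff.neg (Complex.ofRealCLM.contDiff.comp
    (contDiff_dotProduct_mulVec A contDiff_id contDiff_id))) 2)

theorem contDiff_gaussianLin (j : Fin n) : ContDiff ℝ ∞ (gaussianLin A Θ j) := by
  have h : ∀ a, ContDiff ℝ ∞ fun u : Fin n → ℝ => (u a : ℂ) := fun a =>
    Complex.ofRealCLM.contDiff.comp (contDiff_apply ℝ ℝ a)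
  exact contDiff_const.mul (ContDiff.sum fun a _ => contDiff_const.mul (h a))

theorem gaussianLin_zero (j : Fin n) : gaussianLin A Θ j 0 = 0 := by
  simp [gaussianLin]

theorem hasDerivAt_gaussianLin (j k : Fin n) (u : Fin n → ℝ) :
    HasDerivAt (fun t : ℝ => gaussianLin A Θ j (u + t • Pi.single k 1))
      (Complex.I * gaussianCov A Θ j k) 0 := by
  have h : ∀ t : ℝ, gaussianLin A Θ j (u + t • Pi.single k 1) =
      gaussianLin A Θ j u + t * (Complex.I * gaussianCov A Θ j k) := by
    intro t
    have h1 : ∑ a, gaussianCov A Θ j a * (((t • Pi.single k 1 : Fin n → ℝ) a : ℝ) : ℂ) =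
        gaussianCov A Θ j k * t := by
      rw [Finset.sum_eq_single k (fun a _ ha => by simp [ha]) (by simp)]
      simp
    simp only [gaussianLin, Pi.add_apply, Complex.ofReal_add, mul_add, Finset.sum_add_distrib, h1]
    ring
  simp only [h]
  simpa using ((Complex.ofRealCLM.hasDerivAt (x := 0)).mul_const
    (Complex.I * gaussianCov A Θ j k)).const_add (gaussianLin A Θ j u)

theorem hasDerivAt_gaussianCharFun (k : Fin n) (u : Fin n → ℝ) :
    HasDerivAt (fun t : ℝ => gaussianCharFun A (u + t • Pi.single k 1))
      (-((∑ a, (A k a + A a k) / 2 * u a : ℝ) : ℂ) * gaussianCharFun A u) 0 := by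
  set e : Fin n → ℝ := Pi.single k 1
  have h : ∀ t : ℝ, (u + t • e) ⬝ᵥ (A *ᵥ (u + t • e)) =
      u ⬝ᵥ (A *ᵥ u) + t * (2 * ∑ a, (A k a + A a k) / 2 * u a) + t ^ 2 * A k k := by
    intro t
    have h1 : e ⬝ᵥ (A *ᵥ u) = ∑ a, A k a * u a := by
      simp only [e, single_one_dotProduct]
      rfl
    have h2 : u ⬝ᵥ (A *ᵥ e) = ∑ a, A a k * u a := by
      simp [e, dotProduct, mul_comm]
    have h3 : e ⬝ᵥ (A *ᵥ e) = A k k := by simp [e]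
    have h4 : 2 * ∑ a, (A k a + A a k) / 2 * u a = ∑ a, A k a * u a + ∑ a, A a k * u a := by
      rw [Finset.mul_sum, ← Finset.sum_add_distrib]
      exact Finset.sum_congr rfl fun a _ => by ring
    simp only [Matrix.mulVec_add, Matrix.mulVec_smul, dotProduct_add, add_dotProduct,
      dotProduct_smul, smul_dotProduct, h1, h2, h3, h4, smul_eq_mul]
    ring
  have h5 : HasDerivAt (fun t : ℝ => (u + t • e) ⬝ᵥ (A *ᵥ (u + t • e)))
      (2 * ∑ a, (A k a + A a k) / 2 * u a) 0 := by
    simp only [h]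
    refine (((hasDerivAt_mul_const (2 * ∑ a, (A k a + A a k) / 2 * u a)).const_add
      (u ⬝ᵥ (A *ᵥ u))).add ((hasDerivAt_pow 2 (0 : ℝ)).mul_const (A k k))).congr_deriv ?_
    simp
  have h6 := ((h5.ofReal_comp.neg).div_const 2).cexp
  simp only [zero_smul, add_zero, Pi.neg_apply] at h6
  refine h6.congr_deriv ?_
  rw [gaussianCharFun]
  push_cast
  ring

/-- On products `p χ` with the Gaussian characteristic function `χ`, the operator `D k` acts as
`-i ∂ₖ + i (S u)ₖ` on the factor `p`. -/
theorem momentDeriv_mul_gaussianCharFun {p : (Fin n → ℝ) → ℂ} (hp : ContDiff ℝ ∞ p) (k : Fin n)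
    {u : Fin n → ℝ} {p' : ℂ} (h : HasDerivAt (fun t : ℝ => p (u + t • Pi.single k 1)) p' 0) :
    momentDeriv Θ k (fun u => p u * gaussianCharFun A u) u =
      (-Complex.I * p' + gaussianLin A Θ k u * p u) * gaussianCharFun A u := by
  have hd : Differentiable ℝ fun u => p u * gaussianCharFun A u :=
    (hp.mul (contDiff_gaussianCharFun A)).differentiable (by simp)
  rw [momentDeriv_eq_of_hasDerivAt Θ k hd (h.mul (hasDerivAt_gaussianCharFun A k u))]
  have e : gaussianLin A Θ k u = Complex.I * ((∑ a, (A k a + A a k) / 2 * u a : ℝ) : ℂ) -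
      (((Θ *ᵥ u) k / 2 : ℝ) : ℂ) := by
    have hI : Complex.I * (Complex.I / 2) = -(1 / 2) := by
      rw [← mul_div_assoc, Complex.I_mul_I]
      norm_num
    simp only [gaussianLin, gaussianCov, add_mul, Finset.sum_add_distrib, mul_add, mul_assoc,
      ← Finset.mul_sum]
    rw [← mul_assoc Complex.I, hI]
    simp only [Matrix.mulVec, dotProduct]
    push_cast
    ring
  rw [e]
  simp only [zero_smul, add_zero, smul_eq_mul]
  ring

theorem momentDeriv_gaussianCharFun (j : Fin n) :
    momentDeriv Θ j (gaussianCharFun A) =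
      fun u => gaussianLin A Θ j u * gaussianCharFun A u := by
  ext u
  have := momentDeriv_mul_gaussianCharFun A Θ (p := fun _ => 1) contDiff_const j (u := u)
    (hasDerivAt_const _ _)
  simpa using this

theorem momentDeriv_momentDeriv_gaussianCharFun (j k : Fin n) :
    momentDeriv Θ k (momentDeriv Θ j (gaussianCharFun A)) = fun u =>
      (gaussianCov A Θ j k + gaussianLin A Θ k u * gaussianLin A Θ j u) *
        gaussianCharFun A u := by
  ext u
  rw [momentDeriv_gaussianCharFun, momentDeriv_mul_gaussianCharFun A Θ (contDiff_gaussianLin A Θ j)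
    k (hasDerivAt_gaussianLin A Θ j k u)]
  rw [← mul_assoc, neg_mul, Complex.I_mul_I, neg_neg, one_mul]

theorem gaussianCharFun_zero : gaussianCharFun A 0 = 1 := by
  simp [gaussianCharFun]

/-- The second moments of a Gaussian characteristic function. -/
theorem momentDeriv_two_gaussianCharFun_zero (j k : Fin n) :
    momentDeriv Θ k (momentDeriv Θ j (gaussianCharFun A)) 0 = gaussianCov A Θ j k := by
  rw [momentDeriv_momentDeriv_gaussianCharFun]
  simp [gaussianLin_zero, gaussianCharFun_zero]

/-- Wick's formula for the fourth moments of a Gaussian characteristic function. -/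
theorem momentDeriv_four_gaussianCharFun_zero (j k l m : Fin n) :
    momentDeriv Θ m (momentDeriv Θ l (momentDeriv Θ k (momentDeriv Θ j (gaussianCharFun A)))) 0 =
      gaussianCov A Θ j k * gaussianCov A Θ l m + gaussianCov A Θ j l * gaussianCov A Θ k m +
        gaussianCov A Θ j m * gaussianCov A Θ k l := by
  have hL := contDiff_gaussianLin A Θ
  have hD := hasDerivAt_gaussianLin A Θ
  have h3 : momentDeriv Θ l (momentDeriv Θ k (momentDeriv Θ j (gaussianCharFun A))) = fun u =>
      (gaussianCov A Θ k l * gaussianLin A Θ j u + gaussianCov A Θ j l * gaussianLin A Θ k u +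
        gaussianLin A Θ l u *
          (gaussianCov A Θ j k + gaussianLin A Θ k u * gaussianLin A Θ j u)) *
        gaussianCharFun A u := by
    ext u
    rw [momentDeriv_momentDeriv_gaussianCharFun, momentDeriv_mul_gaussianCharFun A Θ
      (contDiff_const.add ((hL k).mul (hL j))) l (((hD k l u).mul (hD j l u)).const_add _)]
    simp only [zero_smul, add_zero]
    linear_combination (-(gaussianCov A Θ k l * gaussianLin A Θ j u +
      gaussianCov A Θ j l * gaussianLin A Θ k u)) * gaussianCharFun A u * Complex.I_mul_I
  rw [h3, momentDeriv_mul_gaussianCharFun A Θ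
    (((contDiff_const.mul (hL j)).add (contDiff_const.mul (hL k))).add
      ((hL l).mul (contDiff_const.add ((hL k).mul (hL j))))) m
    ((((hD j m 0).const_mul _).add ((hD k m 0).const_mul _)).add
      ((hD l m 0).mul (((hD k m 0).mul (hD j m 0)).const_add _)))]
  simp only [zero_smul, add_zero, gaussianLin_zero, gaussianCharFun_zero, mul_zero, zero_mul,
    mul_one]
  linear_combination (-(gaussianCov A Θ k l * gaussianCov A Θ j m +
    gaussianCov A Θ j l * gaussianCov A Θ k m + gaussianCov A Θ l m * gaussianCov A Θ j k)) *
    Complex.I_mul_I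

end Wick

/-! ### Orbits in the Hilbert–Schmidt space and the moments of a Gaussian state -/

namespace CanonicalSystem

variable {n : ℕ} {H : Type u} [NormedAddCommGroup H] [InnerProductSpace ℂ H] [CompleteSpace H]
  {sys : CanonicalSystem n H} {ρ s : H →L[ℂ] H} {ι : Type u} {b : HilbertBasis ι ℂ H}

variable (sys ρ) in
/-- The orbit `u ↦ exp (i uᵀ ξ) s` of the square root `s` of the density operator `ρ`, as a map
into the Hilbert–Schmidt operators. -/
noncomputable def orbitHS (hT : Summable fun i => ‖s (b i)‖ ^ 2) (u : Fin n → ℝ) :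
    lp (fun _ : ι => H) 2 :=
  toHS b (sys.centeredW ρ u * s) (summable_mul_sqrt b hT _)

variable (hT : Summable fun i => ‖s (b i)‖ ^ 2)

theorem evalHS_orbitHS (φ : H) (u : Fin n → ℝ) :
    evalHS b φ (sys.orbitHS ρ hT u) = sys.centeredW ρ u (s φ) :=
  evalHS_toHS b _ _ φ

theorem orbitHS_zero : sys.orbitHS ρ hT 0 = toHS b s hT := by
  ext i
  simp [orbitHS, toHS_apply, centeredW_zero]

variable (hG : sys.IsGaussian ρ) (hm : ∀ j, (expectation ρ (sys.x j)).im = 0)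
  (hs : IsSelfAdjoint s) (hss : s * s = ρ)

include hG hs hss in
theorem inner_orbitHS_zero (u : Fin n → ℝ) :
    inner ℂ (sys.orbitHS ρ hT 0) (sys.orbitHS ρ hT u) = gaussianCharFun (sys.Sig ρ) u := by
  obtain ⟨_, h⟩ := hG.charFun u
  rw [orbitHS_zero]
  exact inner_toHS_of_hasTrace b hs hss hT h

include hm in
/-- The Weyl relations reduce the Gram kernel of the orbit to the characteristic function. -/
theorem inner_orbitHS (v u : Fin n → ℝ) :
    inner ℂ (sys.orbitHS ρ hT v) (sys.orbitHS ρ hT u) =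
      Complex.exp (Complex.I / 2 * ((v ⬝ᵥ (sys.Θ *ᵥ u) : ℝ) : ℂ)) *
        inner ℂ (sys.orbitHS ρ hT 0) (sys.orbitHS ρ hT (u - v)) := by
  have h := (lp.hasSum_inner (sys.orbitHS ρ hT 0) (sys.orbitHS ρ hT (u - v))).mul_left
    (Complex.exp (Complex.I / 2 * ((v ⬝ᵥ (sys.Θ *ᵥ u) : ℝ) : ℂ)))
  refine (lp.hasSum_inner _ _).unique (h.congr_fun fun i => ?_)
  simp only [orbitHS, toHS_apply, mul_apply_eq_comp, centeredW_zero, one_apply_eq_self]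
  rw [← ContinuousLinearMap.adjoint_inner_right, ← ContinuousLinearMap.star_eq_adjoint,
    star_centeredW hm, ← mul_apply_eq_comp, centeredW_mul, smul_apply, inner_smul_right,
    neg_add_eq_sub]
  congr 2
  simp

include hG hm hs hss in
theorem contDiff_orbitHS : ContDiff ℝ ∞ (sys.orbitHS ρ hT) := by
  refine contDiff_of_contDiff_gram ?_
  have h : (fun p : (Fin n → ℝ) × (Fin n → ℝ) =>
      inner ℂ (sys.orbitHS ρ hT p.1) (sys.orbitHS ρ hT p.2)) = fun p =>
      Complex.exp (Complex.I / 2 * ((p.1 ⬝ᵥ (sys.Θ *ᵥ p.2) : ℝ) : ℂ)) *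
        gaussianCharFun (sys.Sig ρ) (p.2 - p.1) := by
    ext p
    rw [inner_orbitHS hT hm, inner_orbitHS_zero hT hG hs hss]
  rw [h]
  refine ContDiff.mul ?_ ((contDiff_gaussianCharFun _).comp (contDiff_snd.sub contDiff_fst))
  exact ContDiff.cexp (contDiff_const.mul (Complex.ofRealCLM.contDiff.comp
    (contDiff_dotProduct_mulVec sys.Θ contDiff_fst contDiff_snd)))

include hG hm hs hss

theorem mem_graph_ξ_orbitHS (j : Fin n) (φ : H) (u : Fin n → ℝ) :
    (evalHS b φ (sys.orbitHS ρ hT u),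
      evalHS b φ (momentDeriv sys.Θ j (sys.orbitHS ρ hT) u)) ∈ (sys.ξ ρ j).graph := by
  have hd := (contDiff_orbitHS hT hG hm hs hss).differentiable (by simp)
  have h1 := fun u => (evalHS b φ).restrictScalars ℝ |>.differentiable.comp hd u
  rw [← momentDeriv_comp _ _ _ hd]
  have h2 : (fun u => evalHS b φ (sys.orbitHS ρ hT u)) = fun u => sys.centeredW ρ u (s φ) :=
    funext fun u => evalHS_orbitHS hT φ u
  have h3 : Differentiable ℝ fun u => sys.centeredW ρ u (s φ) := h2 ▸ h1
  rw [h2, evalHS_orbitHS]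
  exact mem_graph_ξ_of_differentiable j h3 u

omit hG hm hs hss in
/-- If `ξ j` maps the family `G` to `G'`, then it maps `D k G` to `D k G'`, since it is closed. -/
theorem mem_graph_ξ_momentDeriv (j k : Fin n) (φ : H) {G G' : (Fin n → ℝ) → lp (fun _ : ι => H) 2}
    (hG : ContDiff ℝ ∞ G) (hG' : ContDiff ℝ ∞ G')
    (h : ∀ u, (evalHS b φ (G u), evalHS b φ (G' u)) ∈ (sys.ξ ρ j).graph) (u : Fin n → ℝ) :
    (evalHS b φ (momentDeriv sys.Θ k G u), evalHS b φ (momentDeriv sys.Θ k G' u)) ∈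
      (sys.ξ ρ j).graph := by
  have hd := hG.differentiable (by simp)
  have hd' := hG'.differentiable (by simp)
  rw [← momentDeriv_comp _ _ _ hd, ← momentDeriv_comp _ _ _ hd']
  exact momentDeriv_mem_of_isClosed _ _ (isClosed_graph_ξ j)
    (((evalHS b φ).restrictScalars ℝ).differentiable.comp hd)
    (((evalHS b φ).restrictScalars ℝ).differentiable.comp hd') h u

end CanonicalSystem

namespace CanonicalSystem

variable {n : ℕ} {H : Type u} [NormedAddCommGroup H] [InnerProductSpace ℂ H] [CompleteSpace H]
  {sys : CanonicalSystem n H} {ρ s : H →L[ℂ] H}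

theorem inner_orbitHS_momentDeriv {ι : Type u} {b : HilbertBasis ι ℂ H}
    (hT : Summable fun i => ‖s (b i)‖ ^ 2) (j : Fin n)
    {G : (Fin n → ℝ) → lp (fun _ : ι => H) 2} {g : (Fin n → ℝ) → ℂ} (hG : ContDiff ℝ ∞ G)
    (h : ∀ u, inner ℂ (sys.orbitHS ρ hT 0) (G u) = g u) (u : Fin n → ℝ) :
    inner ℂ (sys.orbitHS ρ hT 0) (momentDeriv sys.Θ j G u) = momentDeriv sys.Θ j g u := by
  have := momentDeriv_comp sys.Θ j (innerSL ℂ (sys.orbitHS ρ hT 0))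
    (hG.differentiable (by simp)) u
  rw [← show (fun u => innerSL ℂ (sys.orbitHS ρ hT 0) (G u)) = g from funext h]
  exact this.symm

theorem hasSum_trace_orbitHS {ι : Type u} {b : HilbertBasis ι ℂ H}
    (hT : Summable fun i => ‖s (b i)‖ ^ 2) (hs : IsSelfAdjoint s)
    (G : lp (fun _ : ι => H) 2) :
    HasSum (fun i => inner ℂ (b i) (evalHS b (s (b i)) G)) (inner ℂ (sys.orbitHS ρ hT 0) G) := by
  rw [orbitHS_zero]
  exact hasSum_trace_evalHS b s hs hT G

theorem evalHS_orbitHS_zero {ι : Type u} {b : HilbertBasis ι ℂ H}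
    (hT : Summable fun i => ‖s (b i)‖ ^ 2) (hss : s * s = ρ) (φ : H) :
    evalHS b (s φ) (sys.orbitHS ρ hT 0) = ρ φ := by
  rw [evalHS_orbitHS, centeredW_zero, ← hss]
  rfl

/-- The second moments of a Gaussian state, in terms of the symmetric part of `Σ`. That `Σ` is
itself symmetric is a consequence of this formula. -/
theorem IsGaussian.hasExpectation_mul (hG : sys.IsGaussian ρ) (hρ : IsDensityOperator ρ)
    (j k : Fin n) : HasExpectation ρ (opMul (sys.ξ ρ j) (sys.ξ ρ k))
      (gaussianCov (sys.Sig ρ) sys.Θ j k) := by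
  obtain ⟨s, hs, hss⟩ := exists_selfAdjoint_sqrt hρ.1
  have hm := hG.mean_im hρ
  refine HasExpectation.of_forall_hilbertBasis fun ι b => ?_
  have hT := summable_sqrt_of_isDensityOperator b hρ hs hss
  set F := sys.orbitHS ρ hT
  have hF : ContDiff ℝ ∞ F := contDiff_orbitHS hT hG hm hs hss
  have hD : ∀ i {G : (Fin n → ℝ) → lp (fun _ : ι => H) 2}, ContDiff ℝ ∞ G →
      ContDiff ℝ ∞ (momentDeriv sys.Θ i G) := fun i _ h => contDiff_momentDeriv _ _ h
  refine ⟨fun ψ => evalHS b (s ψ) (momentDeriv sys.Θ k (momentDeriv sys.Θ j F) 0), fun ψ => ?_, ?_⟩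
  · rw [← evalHS_orbitHS_zero (sys := sys) hT hss]
    have h1 := fun i => mem_graph_ξ_orbitHS hT hG hm hs hss i (s ψ)
    exact mem_graph_opMul (h1 k 0) (mem_graph_ξ_momentDeriv j k _ hF (hD j hF) (h1 j) 0)
  · rw [← momentDeriv_two_gaussianCharFun_zero,
      ← inner_orbitHS_momentDeriv hT k (hD j hF) (inner_orbitHS_momentDeriv hT j hF
        (inner_orbitHS_zero hT hG hs hss))]
    exact hasSum_trace_orbitHS hT hs _

/-- Existence and value (Wick's formula) of the fourth moments of a Gaussian state. -/
theorem IsGaussian.hasExpectation_ξ4 (hG : sys.IsGaussian ρ) (hρ : IsDensityOperator ρ)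
    (j k l m : Fin n) : HasExpectation ρ (sys.ξ4 ρ j k l m)
      (gaussianCov (sys.Sig ρ) sys.Θ j k * gaussianCov (sys.Sig ρ) sys.Θ l m +
        gaussianCov (sys.Sig ρ) sys.Θ j l * gaussianCov (sys.Sig ρ) sys.Θ k m +
        gaussianCov (sys.Sig ρ) sys.Θ j m * gaussianCov (sys.Sig ρ) sys.Θ k l) := by
  obtain ⟨s, hs, hss⟩ := exists_selfAdjoint_sqrt hρ.1
  have hm := hG.mean_im hρ
  refine HasExpectation.of_forall_hilbertBasis fun ι b => ?_
  have hT := summable_sqrt_of_isDensityOperator b hρ hs hss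
  set F := sys.orbitHS ρ hT
  set D := momentDeriv (E := lp (fun _ : ι => H) 2) sys.Θ
  have hF : ContDiff ℝ ∞ F := contDiff_orbitHS hT hG hm hs hss
  have hD : ∀ i {G : (Fin n → ℝ) → lp (fun _ : ι => H) 2}, ContDiff ℝ ∞ G →
      ContDiff ℝ ∞ (D i G) := fun i _ h => contDiff_momentDeriv _ _ h
  refine ⟨fun ψ => evalHS b (s ψ) (D m (D l (D k (D j F))) 0), fun ψ => ?_, ?_⟩
  · rw [← evalHS_orbitHS_zero (sys := sys) hT hss]
    have h1 := fun i => mem_graph_ξ_orbitHS hT hG hm hs hss i (s ψ)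
    have step := fun i i' (G G' : (Fin n → ℝ) → lp (fun _ : ι => H) 2) =>
      mem_graph_ξ_momentDeriv (sys := sys) (ρ := ρ) (b := b) i i' (s ψ) (G := G) (G' := G')
    -- `ξ j` maps `D m D l D k F` to `D m D l D k D j F`, and so on down to `ξ m`, which maps `F`
    -- to `D m F`.
    have hj := step j m _ _ (hD l (hD k hF)) (hD l (hD k (hD j hF)))
      (step j l _ _ (hD k hF) (hD k (hD j hF)) (step j k _ _ hF (hD j hF) (h1 j)))
    have hk := step k m _ _ (hD l hF) (hD l (hD k hF)) (step k l _ _ hF (hD k hF) (h1 k))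
    have hl := step l m _ _ hF (hD l hF) (h1 l)
    exact mem_graph_opMul (mem_graph_opMul (mem_graph_opMul (h1 m 0) (hl 0)) (hk 0)) (hj 0)
  · rw [← momentDeriv_four_gaussianCharFun_zero,
      ← inner_orbitHS_momentDeriv hT m (hD l (hD k (hD j hF)))
        (inner_orbitHS_momentDeriv hT l (hD k (hD j hF)) (inner_orbitHS_momentDeriv hT k (hD j hF)
          (inner_orbitHS_momentDeriv hT j hF (inner_orbitHS_zero hT hG hs hss))))]
    exact hasSum_trace_orbitHS hT hs _

theorem IsGaussian.S_apply (hG : sys.IsGaussian ρ) (hρ : IsDensityOperator ρ) (j k : Fin n) :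
    sys.S ρ j k = gaussianCov (sys.Sig ρ) sys.Θ j k :=
  (hG.hasExpectation_mul hρ j k).expectation_eq

/-- The covariance matrix is the Gram matrix of the vectors `ξ j s` in the Hilbert–Schmidt space,
where `s` is the square root of the density operator. -/
theorem IsGaussian.posSemidef_S (hG : sys.IsGaussian ρ) (hρ : IsDensityOperator ρ) :
    (sys.S ρ).PosSemidef := by
  obtain ⟨s, hs, hss⟩ := exists_selfAdjoint_sqrt hρ.1
  have hm := hG.mean_im hρ
  obtain ⟨w, b, -⟩ := exists_hilbertBasis ℂ H
  have hT := summable_sqrt_of_isDensityOperator b hρ hs hss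
  set F := sys.orbitHS ρ hT
  have hF : ContDiff ℝ ∞ F := contDiff_orbitHS hT hG hm hs hss
  have hDF : ∀ j, ContDiff ℝ ∞ (momentDeriv sys.Θ j F) := fun j => contDiff_momentDeriv _ _ hF
  have hgram : sys.S ρ = Matrix.gram ℂ fun j => momentDeriv sys.Θ j F 0 := by
    ext j k
    rw [hG.S_apply hρ, Matrix.gram_apply, ← momentDeriv_two_gaussianCharFun_zero,
      ← inner_orbitHS_momentDeriv hT k (hDF j) (inner_orbitHS_momentDeriv hT j hF
        (inner_orbitHS_zero hT hG hs hss))]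
    refine (lp.hasSum_inner _ _).unique ((lp.hasSum_inner _ _).congr_fun fun i => ?_)
    have h1 := mem_graph_ξ_orbitHS hT hG hm hs hss j (b i)
    have h2 := mem_graph_ξ_momentDeriv j k (b i) hF (hDF j) h1 0
    have h3 := mem_graph_sub_scalarOp_inner_eq (sys.selfAdjoint j) (hm j) (h1 0) h2
    simpa only [evalHS_basis] using h3.symm
  rw [hgram]
  exact Matrix.posSemidef_gram ℂ _

/-- `Σ` is equal to its symmetric part: compare the real parts in `IsGaussian.S_apply`. -/
theorem IsGaussian.Sig_apply (hG : sys.IsGaussian ρ) (hρ : IsDensityOperator ρ) (j k : Fin n) :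
    sys.Sig ρ j k = (sys.Sig ρ j k + sys.Sig ρ k j) / 2 := by
  have h := congrArg Complex.re (hG.S_apply hρ j k)
  rw [gaussianCov] at h
  simpa [S, Sig] using h

theorem IsGaussian.isSymm_Sig (hG : sys.IsGaussian ρ) (hρ : IsDensityOperator ρ) :
    (sys.Sig ρ).IsSymm :=
  Matrix.IsSymm.ext fun j k => by
    linarith [hG.Sig_apply hρ j k]

theorem IsGaussian.S_eq (hG : sys.IsGaussian ρ) (hρ : IsDensityOperator ρ) :
    sys.S ρ = (sys.Sig ρ).map Complex.ofReal + (Complex.I / 2) • sys.Θ.map Complex.ofReal := by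
  ext j k
  rw [hG.S_apply hρ, gaussianCov, ← hG.Sig_apply hρ]
  rfl

end CanonicalSystem

/-! ### The operator `K` on symmetric matrices -/

section Matrices

open scoped MatrixOrder

variable {n : ℕ}

theorem sum_sum_mul_eq_mul_mul_transpose (X Y R : Matrix (Fin n) (Fin n) ℝ) (j k : Fin n) :
    ∑ l, ∑ m, X j l * Y k m * R l m = (X * R * Yᵀ) j k := by
  simp only [Matrix.mul_apply, Matrix.transpose_apply, Finset.sum_mul]
  rw [Finset.sum_comm]
  exact Finset.sum_congr rfl fun m _ => Finset.sum_congr rfl fun l _ => by ring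

theorem sum_sum_mul_eq_mul_transpose_mul_transpose (X Y R : Matrix (Fin n) (Fin n) ℝ)
    (j k : Fin n) : ∑ l, ∑ m, X j m * Y k l * R l m = (X * Rᵀ * Yᵀ) j k := by
  rw [Finset.sum_comm]
  exact sum_sum_mul_eq_mul_mul_transpose X Y Rᵀ j k

variable {A Θ : Matrix (Fin n) (Fin n) ℝ}

/-- The operator `K (R) = A R A + Θ R Θ / 4` on the space of real symmetric matrices. -/
noncomputable def quarticOp (hA : A.IsSymm) (hΘ : Θᵀ = -Θ) : SymMat n →ₗ[ℝ] SymMat n where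
  toFun R := ⟨A * (R : Matrix (Fin n) (Fin n) ℝ) * A +
      (1 / 4 : ℝ) • (Θ * (R : Matrix (Fin n) (Fin n) ℝ) * Θ), by
    have hR : (R : Matrix (Fin n) (Fin n) ℝ)ᵀ = R := R.2
    change (_ + _)ᵀ = _
    simp only [Matrix.transpose_add, Matrix.transpose_smul, Matrix.transpose_mul, hA.eq, hΘ, hR,
      neg_mul, mul_neg, neg_neg, mul_assoc]⟩
  map_add' R T := by
    ext1
    simp only [Submodule.coe_add, mul_add, add_mul, smul_add]
    abel
  map_smul' c R := by
    ext1
    simp only [Submodule.coe_smul, mul_smul_comm, smul_mul_assoc, smul_add, RingHom.id_apply,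
      smul_comm c]

variable (hA : A.IsSymm) (hΘ : Θᵀ = -Θ)

theorem frob_quarticOp_left (R T : SymMat n) :
    frob (quarticOp hA hΘ R : Matrix (Fin n) (Fin n) ℝ) T =
      frob (R : Matrix (Fin n) (Fin n) ℝ) (quarticOp hA hΘ T) := by
  have h : ∀ X Y Z : Matrix (Fin n) (Fin n) ℝ, (X * Y * X * Z).trace = (Y * (X * Z * X)).trace := by
    intro X Y Z
    rw [mul_assoc X, mul_assoc X, Matrix.trace_mul_comm]
    simp only [mul_assoc]
  simp only [frob, quarticOp, LinearMap.coe_mk, AddHom.coe_mk, add_mul, mul_add, Matrix.trace_add,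
    smul_mul_assoc, mul_smul_comm, Matrix.trace_smul, h]

/-- `⟨R, K (R)⟩ = Tr (R S R Sᵀ)` for `S = A + (i / 2) Θ`: the terms linear in `Θ` cancel. -/
theorem ofReal_frob_quarticOp {S : Matrix (Fin n) (Fin n) ℂ}
    (hS : S = A.map Complex.ofReal + (Complex.I / 2) • Θ.map Complex.ofReal) (R : SymMat n) :
    ((frob (R : Matrix (Fin n) (Fin n) ℝ) (quarticOp hA hΘ R) : ℝ) : ℂ) =
      ((R : Matrix (Fin n) (Fin n) ℝ).map Complex.ofReal * S *
        (R : Matrix (Fin n) (Fin n) ℝ).map Complex.ofReal * Sᵀ).trace := by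
  obtain ⟨R, hR⟩ := R
  have hST : Sᵀ = A.map Complex.ofReal - (Complex.I / 2) • Θ.map Complex.ofReal := by
    rw [hS, Matrix.transpose_add, Matrix.transpose_smul, ← Matrix.transpose_map,
      ← Matrix.transpose_map, hA.eq, hΘ, Matrix.map_neg _ Complex.ofReal_neg, smul_neg,
      sub_eq_add_neg]
  have hmap : ∀ X Y : Matrix (Fin n) (Fin n) ℝ,
      (X * Y).map Complex.ofReal = X.map Complex.ofReal * Y.map Complex.ofReal := fun X Y =>
    Matrix.map_mul (f := Complex.ofRealHom)
  have htr : ∀ X : Matrix (Fin n) (Fin n) ℝ,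
      ((X.trace : ℝ) : ℂ) = (X.map Complex.ofReal).trace := fun X => by
    simp [Matrix.trace]
  have e : frob R (quarticOp hA hΘ ⟨R, hR⟩ : Matrix (Fin n) (Fin n) ℝ) =
      (R * A * R * A).trace + 1 / 4 * (R * Θ * R * Θ).trace := by
    simp only [frob, quarticOp, LinearMap.coe_mk, AddHom.coe_mk, mul_add, Matrix.trace_add,
      mul_smul_comm, Matrix.trace_smul, mul_assoc, smul_eq_mul]
  have hI : Complex.I / 2 * (Complex.I / 2) = -(1 / 4) := by
    linear_combination (1 / 4 : ℂ) * Complex.I_mul_I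
  rw [e, hST, hS]
  push_cast
  simp only [htr, hmap, mul_add, add_mul, mul_sub, Matrix.trace_add, Matrix.trace_sub,
    mul_smul_comm, smul_mul_assoc, Matrix.trace_smul, smul_eq_mul]
  rw [mul_assoc (R.map Complex.ofReal * A.map Complex.ofReal) (R.map Complex.ofReal)
      (Θ.map Complex.ofReal), Matrix.trace_mul_comm (R.map Complex.ofReal * A.map Complex.ofReal),
    ← mul_assoc]
  linear_combination (R.map Complex.ofReal * Θ.map Complex.ofReal * R.map Complex.ofReal *
    Θ.map Complex.ofReal).trace * hI

/-- `Tr (R S R Sᵀ) = Tr (M Mᴴ)` with `M = C R Bᴴ`, where `S = Bᴴ B` and `Sᵀ = Cᴴ C`. -/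
theorem exists_trace_eq_trace_mul_conjTranspose {S : Matrix (Fin n) (Fin n) ℂ}
    (hS : S.PosSemidef) : ∃ B C : Matrix (Fin n) (Fin n) ℂ, S = Bᴴ * B ∧ Sᵀ = Cᴴ * C ∧
      ∀ R : Matrix (Fin n) (Fin n) ℂ, Rᴴ = R →
        (R * S * R * Sᵀ).trace = ((C * R * Bᴴ) * (C * R * Bᴴ)ᴴ).trace := by
  obtain ⟨B, hB⟩ := CStarAlgebra.nonneg_iff_eq_star_mul_self.1 hS.nonneg
  obtain ⟨C, hC⟩ := CStarAlgebra.nonneg_iff_eq_star_mul_self.1 hS.transpose.nonneg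
  refine ⟨B, C, hB, hC, fun R hR => ?_⟩
  rw [hC, hB, Matrix.star_eq_conjTranspose, Matrix.star_eq_conjTranspose]
  simp only [Matrix.conjTranspose_mul, Matrix.conjTranspose_conjTranspose, hR]
  rw [← mul_assoc, Matrix.trace_mul_comm]
  simp only [mul_assoc]

theorem conjTranspose_map_ofReal (R : SymMat n) :
    ((R : Matrix (Fin n) (Fin n) ℝ).map Complex.ofReal)ᴴ =
      (R : Matrix (Fin n) (Fin n) ℝ).map Complex.ofReal := by
  ext j k
  simp only [Matrix.conjTranspose_apply, Matrix.map_apply]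
  rw [Matrix.IsSymm.apply R.2 j k]
  exact Complex.conj_ofReal _

theorem isPosSemidefOp_quarticOp
    (hS : (A.map Complex.ofReal + (Complex.I / 2) • Θ.map Complex.ofReal).PosSemidef) :
    IsPosSemidefOp (quarticOp hA hΘ) where
  selfAdjoint := frob_quarticOp_left hA hΘ
  nonneg R := by
    obtain ⟨B, C, -, -, h⟩ := exists_trace_eq_trace_mul_conjTranspose hS
    have h0 := (Matrix.posSemidef_self_mul_conjTranspose
      (C * (R : Matrix (Fin n) (Fin n) ℝ).map Complex.ofReal * Bᴴ)).trace_nonneg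
    rw [← h _ (conjTranspose_map_ofReal R), ← ofReal_frob_quarticOp hA hΘ rfl] at h0
    exact_mod_cast h0

theorem isPosDefOp_quarticOp
    (hS : (A.map Complex.ofReal + (Complex.I / 2) • Θ.map Complex.ofReal).PosSemidef)
    (hdet : IsUnit (A.map Complex.ofReal + (Complex.I / 2) • Θ.map Complex.ofReal).det) :
    IsPosDefOp (quarticOp hA hΘ) where
  selfAdjoint := frob_quarticOp_left hA hΘ
  pos R hR := by
    refine lt_of_le_of_ne ((isPosSemidefOp_quarticOp hA hΘ hS).nonneg R) fun h0 => hR ?_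
    obtain ⟨B, C, hB, hC, h⟩ := exists_trace_eq_trace_mul_conjTranspose hS
    have h1 := ofReal_frob_quarticOp hA hΘ rfl R
    rw [← h0, h _ (conjTranspose_map_ofReal R), Complex.ofReal_zero, eq_comm,
      Matrix.trace_mul_conjTranspose_self_eq_zero_iff] at h1
    have hBu : IsUnit Bᴴ := by
      rw [hB, Matrix.det_mul] at hdet
      exact (Matrix.isUnit_iff_isUnit_det _).2 (isUnit_of_mul_isUnit_left hdet)
    have hCu : IsUnit C := by
      rw [← Matrix.det_transpose, hC, Matrix.det_mul] at hdet
      exact (Matrix.isUnit_iff_isUnit_det _).2 (isUnit_of_mul_isUnit_right hdet)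
    have h2 := hCu.mul_right_eq_zero.1 (hBu.mul_left_eq_zero.1 h1)
    ext j k
    simpa using congrFun (congrFun h2 j) k

end Matrices

/-! ### The operator `Ψ` -/

namespace CanonicalSystem

variable {n : ℕ} {H : Type u} [NormedAddCommGroup H] [InnerProductSpace ℂ H] [CompleteSpace H]
  {sys : CanonicalSystem n H} {ρ : H →L[ℂ] H}

/-- The real part of Wick's formula. -/
theorem IsGaussian.φ_eq (hG : sys.IsGaussian ρ) (hρ : IsDensityOperator ρ) (j k l m : Fin n) :
    sys.φ ρ j k l m =
      sys.Sig ρ j k * sys.Sig ρ l m - sys.Θ j k * sys.Θ l m / 4 +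
      (sys.Sig ρ j l * sys.Sig ρ k m - sys.Θ j l * sys.Θ k m / 4) +
      (sys.Sig ρ j m * sys.Sig ρ k l - sys.Θ j m * sys.Θ k l / 4) := by
  have h : ∀ a b c d : Fin n,
      (gaussianCov (sys.Sig ρ) sys.Θ a b * gaussianCov (sys.Sig ρ) sys.Θ c d).re =
        sys.Sig ρ a b * sys.Sig ρ c d - sys.Θ a b * sys.Θ c d / 4 := by
    intro a b c d
    simp only [gaussianCov, ← hG.Sig_apply hρ]
    simp
    ring
  rw [φ, (hG.hasExpectation_ξ4 hρ j k l m).expectation_eq, Complex.add_re, Complex.add_re, h, h, h]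

/-- The symmetrisation removes the terms in which `Θ` pairs `j` with `k` or `l` with `m`. -/
theorem IsGaussian.ψ_eq (hG : sys.IsGaussian ρ) (hρ : IsDensityOperator ρ) (j k l m : Fin n) :
    sys.ψ ρ j k l m = sys.Sig ρ j k * sys.Sig ρ l m +
      (sys.Sig ρ j l * sys.Sig ρ k m + sys.Sig ρ j m * sys.Sig ρ k l) -
      (sys.Θ j l * sys.Θ k m + sys.Θ j m * sys.Θ k l) / 4 := by
  have hS : ∀ a b, sys.Sig ρ b a = sys.Sig ρ a b := (hG.isSymm_Sig hρ).apply
  have hΘ : ∀ a b, sys.Θ b a = -sys.Θ a b := fun a b => congrFun (congrFun sys.antisymm a) b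
  simp only [ψ, hG.φ_eq hρ, hS k j, hS m l, hS l j, hS l k, hS m j, hS m k, hΘ j k, hΘ l m,
    hΘ j l, hΘ j m, hΘ k l, hΘ k m]
  rw [hS j l, hS j m, hS k l, hS k m, hS j k, hS l m]
  ring

theorem IsGaussian.Ψ_eq (hG : sys.IsGaussian ρ) (hρ : IsDensityOperator ρ) (R : SymMat n) :
    (sys.Ψ ρ R : Matrix (Fin n) (Fin n) ℝ) =
      frob (sys.Sig ρ) R • sys.Sig ρ +
        (2 : ℝ) • (quarticOp (hG.isSymm_Sig hρ) sys.antisymm R : Matrix (Fin n) (Fin n) ℝ) := by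
  ext j k
  obtain ⟨R, hR⟩ := R
  have hR' : Rᵀ = R := hR
  set A := sys.Sig ρ
  have hA : Aᵀ = A := hG.isSymm_Sig hρ
  have hfrob : frob A R = ∑ l, ∑ m, A l m * R l m := by
    rw [frob, ← hR', Matrix.trace]
    simp only [Matrix.diag_apply, Matrix.mul_apply, Matrix.transpose_apply, hR']
  have h1 := sum_sum_mul_eq_mul_mul_transpose A A R j k
  have h2 := sum_sum_mul_eq_mul_transpose_mul_transpose A A R j k
  have h3 := sum_sum_mul_eq_mul_mul_transpose sys.Θ sys.Θ R j k
  have h4 := sum_sum_mul_eq_mul_transpose_mul_transpose sys.Θ sys.Θ R j k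
  rw [hA] at h1
  rw [hA, hR'] at h2
  rw [sys.antisymm, mul_neg, Matrix.neg_apply] at h3
  rw [sys.antisymm, hR', mul_neg, Matrix.neg_apply] at h4
  have hL : (sys.Ψ ρ ⟨R, hR⟩ : Matrix (Fin n) (Fin n) ℝ) j k =
      A j k * (∑ l, ∑ m, A l m * R l m) + (∑ l, ∑ m, A j l * A k m * R l m) +
        (∑ l, ∑ m, A j m * A k l * R l m) - (∑ l, ∑ m, sys.Θ j l * sys.Θ k m * R l m) / 4 -
        (∑ l, ∑ m, sys.Θ j m * sys.Θ k l * R l m) / 4 := by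
    change ∑ l, ∑ m, sys.ψ ρ j k l m * R l m = _
    simp only [Finset.mul_sum, Finset.sum_div, ← Finset.sum_add_distrib, ← Finset.sum_sub_distrib]
    refine Finset.sum_congr rfl fun l _ => Finset.sum_congr rfl fun m _ => ?_
    rw [hG.ψ_eq hρ]
    ring
  rw [hL, h1, h2, h3, h4, hfrob]
  simp only [quarticOp, LinearMap.coe_mk, AddHom.coe_mk, Matrix.add_apply, Matrix.smul_apply,
    smul_eq_mul]
  ring

end CanonicalSystem

end QuantumGaussian

theorem lemma1 {n : ℕ} {H : Type u} [NormedAddCommGroup H] [InnerProductSpace ℂ H]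
    [CompleteSpace H] (sys : QuantumGaussian.CanonicalSystem n H) (ρ : H →L[ℂ] H)
    (hρ : QuantumGaussian.IsDensityOperator ρ) (hG : sys.IsGaussian ρ) :
    (∀ j k l m, ∃ c, QuantumGaussian.HasExpectation ρ (sys.ξ4 ρ j k l m) c) ∧
    sys.S ρ = (sys.Sig ρ).map Complex.ofReal +
      (Complex.I / 2) • sys.Θ.map Complex.ofReal ∧
    ∃ K : QuantumGaussian.SymMat n →ₗ[ℝ] QuantumGaussian.SymMat n,
      (∀ R : QuantumGaussian.SymMat n, (K R : Matrix (Fin n) (Fin n) ℝ) =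
        sys.Sig ρ * (R : Matrix (Fin n) (Fin n) ℝ) * sys.Sig ρ +
          (1 / 4 : ℝ) • (sys.Θ * (R : Matrix (Fin n) (Fin n) ℝ) * sys.Θ)) ∧
      (∀ R : QuantumGaussian.SymMat n, (sys.Ψ ρ R : Matrix (Fin n) (Fin n) ℝ) =
        QuantumGaussian.frob (sys.Sig ρ) R • sys.Sig ρ +
          (2 : ℝ) • (K R : Matrix (Fin n) (Fin n) ℝ)) ∧
      QuantumGaussian.IsPosSemidefOp K ∧
      (IsUnit (sys.S ρ).det → QuantumGaussian.IsPosDefOp K) := by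
  refine ⟨fun j k l m => ⟨_, hG.hasExpectation_ξ4 hρ j k l m⟩, hG.S_eq hρ,
    QuantumGaussian.quarticOp (hG.isSymm_Sig hρ) sys.antisymm, fun R => rfl, hG.Ψ_eq hρ, ?_, ?_⟩
  · refine QuantumGaussian.isPosSemidefOp_quarticOp _ _ ?_
    rw [← hG.S_eq hρ]
    exact hG.posSemidef_S hρ
  · intro hdet
    refine QuantumGaussian.isPosDefOp_quarticOp _ _ ?_ ?_
    · rw [← hG.S_eq hρ]
      exact hG.posSemidef_S hρ
    · rwa [← hG.S_eq hρ]
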